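/- \textbf{Setting.} Inequalities between vectors and between matrices, $\max$, $M^+=\max(M,0)$, $M^-=M^+-M$ and $|M|=M^++M^-$ are entrywise, while $\succ0$, $\prec0$ mean symmetric positive or negative definite. $M^{\rm d}$ is the diagonal part of a square matrix $M$, $M^{\rm nd}=M-M^{\rm d}$, $M^{\rm m}=M^{\rm d}+|M^{\rm nd}|$, and $M$ is Metzler if its off-diagonal entries are nonnegative. Consider the plant $$x_t^+=\hat f(x_t,u_t)=:f_t(x_t),\qquad y_t=\hat h(x_t,u_t)=:h_t(x_t),\qquad x_t\in\mathcal X\subset\mathbb R^n,\ y_t\in\mathbb R^l,$$ with known input $u_t\in\mathbb R^s$, where $x_t^+=\dot x_t$ and $t\in\mathbb T=[0,\infty)$ (continuous time, CT) or $x_t^+=x_{t+1}$ and $t\in\mathbb T=\{0,1,2,\dots\}$ (discrete time, DT). For $t\in\mathbb T$ let $f_t,h_t$ be differentiable on $\mathcal X$ and locally Lipschitz in $x$ (locally uniformly in $t$), with $\underline J_f\le J_{f_t}(x)\le\overline J_f$ and $\underline J_h\le J_{h_t}(x)\le\overline J_h$ for all $x\in\mathcal X$. Let $A\in\mathbb R^{n\times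 n}$, $C\in\mathbb R^{l\times n}$ be such that $\phi_t(x)=f_t(x)-Ax$ and $\psi_t(x)=h_t(x)-Cx$ are Jacobian sign-stable on $\mathcal X$, i.e. no entry of their Jacobians changes sign on $\mathcal X$. For such a mapping $\mu$ let $\mu_{d,i}(x_1,x_2)=\mu_i(D_ix_1+(I-D_i)x_2)$, where $D_i$ is diagonal with $(D_i)_{jj}=1$ if $\partial\mu_i/\partial x_j\ge0$ on $\mathcal X$ and $(D_i)_{jj}=0$ otherwise. Put $$\overline F_\phi=2\max(\overline J_f-A,0)-\underline J_f+A,\qquad \overline F_\psi=2\max(\overline J_h-C,0)-\underline J_h+C.$$ For a gain $L\in\mathbb R^{n\times l}$ let $M=A-LC$, with $M^\uparrow=M^{\rm d}+(M^{\rm nd})^+$, $M^\downarrow=(M^{\rm nd})^-$ in CT and $M^\uparrow=M^+$, $M^\downarrow=M^-$ in DT. The framer system $\hat{\mathcal G}$ is $$\overline x_t^+=M^\uparrow\overline x_t-M^\downarrow\underline x_t+Ly_t+\phi_{t,d}(\overline x_t,\underline x_t)-L^+\psi_{t,d}(\underline x_t,\overline x_t)+L^-\psi_{t,d}(\overline x_t,\underline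 x_t),$$ $$\underline x_t^+=M^\uparrow\underline x_t-M^\downarrow\overline x_t+Ly_t+\phi_{t,d}(\underline x_t,\overline x_t)-L^+\psi_{t,d}(\overline x_t,\underline x_t)+L^-\psi_{t,d}(\underline x_t,\overline x_t).$$ \textbf{Theorem (Stability).} Suppose there are matrices $P\in\mathbb R^{n\times n}$, $P\succ0$, $X\in\mathbb R^{n\times n}$ and $J\in\mathbb R^{l\times n}$, $J\le0$, such that (i) in the CT case, for some scalar $\alpha>0$ (which may be chosen arbitrarily), $$\begin{bmatrix}\Omega&\Lambda\\\Lambda^\top&-\alpha(X+X^\top)\end{bmatrix}\prec0,\qquad J^\top C\ \text{is Metzler},\qquad X\ \text{is diagonal},$$ where $\Omega=((A^{\rm m})^\top+\overline F_\phi^\top)X+X^\top(A^{\rm m}+\overline F_\phi)+(C^\top-\overline F_\psi^\top)J+J^\top(C-\overline F_\psi)$ and $\Lambda=P+\alpha((A^{\rm m})^\top+\overline F_\phi^\top)X+\alpha(C^\top-\overline F_\psi^\top)J$; (ii) in the DT case, $$\begin{bmatrix}-P&\Gamma\\\Gamma^\top&P-X-X^\top\end{bmatrix}\prec0,\qquad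 J^\top C\le0,\qquad -X\ \text{is Metzler},$$ where $\Gamma=(|A|^\top+\overline F_\phi^\top)X-(|C|^\top+\overline F_\psi^\top)J$. Then $X$ is invertible and, with the gain $L=-(X^\top)^{-1}J^\top$, $\hat{\mathcal G}$ is an interval observer, i.e. a correct and stable framer: for every trajectory $x$ of the plant in $\mathcal X$ and every solution $(\overline x,\underline x)$ of $\hat{\mathcal G}$ on $\mathbb T$ with $\underline x_0\le x_0\le\overline x_0$ such that at all times the box spanned by $\underline x_t$ and $\overline x_t$ is contained in $\mathcal X$, one has $\underline x_t\le x_t\le\overline x_t$ for all $t\in\mathbb T$, and $\lim_{t\to\infty}\|\overline x_t-\underline x_t\|=0$. -/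

import Mathlib

open scoped Matrix NNReal Topology

noncomputable section

/-! ## Entrywise matrix operations -/

/-- `M⁺ = max(M, 0)`, entrywise. -/
def matPos {m n : ℕ} (M : Matrix (Fin m) (Fin n) ℝ) : Matrix (Fin m) (Fin n) ℝ :=
  Matrix.of fun i j => max (M i j) 0

/-- `M⁻ = M⁺ - M`. -/
def matNeg {m n : ℕ} (M : Matrix (Fin m) (Fin n) ℝ) : Matrix (Fin m) (Fin n) ℝ :=
  matPos M - M

/-- `|M| = M⁺ + M⁻`. -/
def matAbs {m n : ℕ} (M : Matrix (Fin m) (Fin n) ℝ) : Matrix (Fin m) (Fin n) ℝ :=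
  matPos M + matNeg M

/-- The diagonal part `Mᵈ`. -/
def matDiag {n : ℕ} (M : Matrix (Fin n) (Fin n) ℝ) : Matrix (Fin n) (Fin n) ℝ :=
  Matrix.diagonal M.diag

/-- The off-diagonal part `Mⁿᵈ = M - Mᵈ`. -/
def matOffDiag {n : ℕ} (M : Matrix (Fin n) (Fin n) ℝ) : Matrix (Fin n) (Fin n) ℝ :=
  M - matDiag M

/-- The "Metzlerization" `Mᵐ = Mᵈ + |Mⁿᵈ|`. -/
def matMetzlerization {n : ℕ} (M : Matrix (Fin n) (Fin n) ℝ) : Matrix (Fin n) (Fin n) ℝ :=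
  matDiag M + matAbs (matOffDiag M)

/-- A Metzler matrix: all off-diagonal entries are nonnegative. -/
def IsMetzler {n : ℕ} (M : Matrix (Fin n) (Fin n) ℝ) : Prop :=
  ∀ i j, i ≠ j → 0 ≤ M i j

/-- Entrywise `M ≤ 0`. -/
def IsNonposMatrix {m n : ℕ} (M : Matrix (Fin m) (Fin n) ℝ) : Prop :=
  ∀ i j, M i j ≤ 0

/-- `M ≺ 0`: symmetric negative definite. -/
def IsNegDef {ι : Type} [Fintype ι] (M : Matrix ι ι ℝ) : Prop :=
  (-M).PosDef

/-! ## Mappings with bounded Jacobian, Jacobian sign-stability -/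

/-- On the time set `𝕋` and the domain `𝒳`, the (time-dependent) mapping `g` is differentiable with
Jacobian matrix `Jg t x`, the Jacobian is entrywise between `Jlo` and `Jup`, and `g` is locally
Lipschitz in the state (locally uniformly in time). The time dependence enters only through the
known input, `g t = ĝ(·, u t)`. -/
structure HasBoundedJacobian {T : Type} [TopologicalSpace T] {n p : ℕ}
    (𝕋 : Set T) (𝒳 : Set (Fin n → ℝ)) (g : T → (Fin n → ℝ) → (Fin p → ℝ))
    (Jg : T → (Fin n → ℝ) → Matrix (Fin p) (Fin n) ℝ)
    (Jlo Jup : Matrix (Fin p) (Fin n) ℝ) : Prop where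
  hasJacobian : ∀ t ∈ 𝕋, ∀ x ∈ 𝒳,
    HasFDerivWithinAt (g t) (LinearMap.toContinuousLinearMap (Matrix.toLin' (Jg t x))) 𝒳 x
  lower_le : ∀ t ∈ 𝕋, ∀ x ∈ 𝒳, ∀ i j, Jlo i j ≤ Jg t x i j
  le_upper : ∀ t ∈ 𝕋, ∀ x ∈ 𝒳, ∀ i j, Jg t x i j ≤ Jup i j
  locallyLipschitz : ∀ t ∈ 𝕋, ∀ x ∈ 𝒳, ∃ K : ℝ≥0, ∃ V ∈ 𝓝[𝕋] t, ∃ U ∈ 𝓝[𝒳] x,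
    ∀ τ ∈ V, LipschitzOnWith K (g τ) U

/-- Jacobian sign-stability on `𝒳` of a mapping with Jacobian `Jμ`: no entry of the Jacobian
changes its sign on `𝒳`. -/
def IsJSS {n p : ℕ} (𝒳 : Set (Fin n → ℝ)) (Jμ : (Fin n → ℝ) → Matrix (Fin p) (Fin n) ℝ) : Prop :=
  ∀ i j, (∀ x ∈ 𝒳, 0 ≤ Jμ x i j) ∨ (∀ x ∈ 𝒳, Jμ x i j ≤ 0)

open Classical in
/-- The tight decomposition function of a JSS mapping `μ` with Jacobian `Jμ`:
`μ_{d,i}(x₁, x₂) = μ_i(D_i x₁ + (I - D_i) x₂)`, where `D_i` is binary diagonal and its `j`-th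
diagonal entry is `1` if `∂μ_i/∂x_j ≥ 0` on `𝒳` and `0` otherwise. -/
def tightDecomp {n p : ℕ} (𝒳 : Set (Fin n → ℝ)) (μ : (Fin n → ℝ) → (Fin p → ℝ))
    (Jμ : (Fin n → ℝ) → Matrix (Fin p) (Fin n) ℝ) (x₁ x₂ : Fin n → ℝ) : Fin p → ℝ :=
  fun i => μ (fun j => if ∀ x ∈ 𝒳, 0 ≤ Jμ x i j then x₁ j else x₂ j) i

/-- The width-bounding matrix `F̄_μ = 2 max(J̄ - H, 0) - J̲ + H` of the remainder
`μ(x) = g(x) - H x` of a mapping `g` whose Jacobian lies in `[J̲, J̄]`. -/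
def widthBound {n p : ℕ} (Jlo Jup H : Matrix (Fin p) (Fin n) ℝ) : Matrix (Fin p) (Fin n) ℝ :=
  (2 : ℝ) • matPos (Jup - H) - Jlo + H

/-! ## The plant and the framer -/

/-- State trajectory in `𝒳` of the continuous-time plant `ẋ = f_t(x)`, `t ≥ 0`. -/
def IsPlantTrajectoryCT {n : ℕ} (𝒳 : Set (Fin n → ℝ)) (f : ℝ → (Fin n → ℝ) → (Fin n → ℝ))
    (x : ℝ → Fin n → ℝ) : Prop :=
  ∀ t ∈ Set.Ici (0 : ℝ), x t ∈ 𝒳 ∧ HasDerivWithinAt x (f t (x t)) (Set.Ici 0) t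

/-- State trajectory in `𝒳` of the discrete-time plant `x_{t+1} = f_t(x_t)`. -/
def IsPlantTrajectoryDT {n : ℕ} (𝒳 : Set (Fin n → ℝ)) (f : ℕ → (Fin n → ℝ) → (Fin n → ℝ))
    (x : ℕ → Fin n → ℝ) : Prop :=
  ∀ t, x t ∈ 𝒳 ∧ x (t + 1) = f t (x t)

/-- The right-hand side of the framer system,
`M↑ a - M↓ b + L y + φ_d(a,b) - L⁺ ψ_d(b,a) + L⁻ ψ_d(a,b)`: with `(a, b) = (x̄, x̲)` it drives the
upper framer, with `(a, b) = (x̲, x̄)` the lower one. -/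
def framerField {n l : ℕ} (Mup Mdown : Matrix (Fin n) (Fin n) ℝ) (L : Matrix (Fin n) (Fin l) ℝ)
    (y : Fin l → ℝ) (φd : (Fin n → ℝ) → (Fin n → ℝ) → (Fin n → ℝ))
    (ψd : (Fin n → ℝ) → (Fin n → ℝ) → (Fin l → ℝ)) (a b : Fin n → ℝ) : Fin n → ℝ :=
  Mup *ᵥ a - Mdown *ᵥ b + L *ᵥ y + φd a b - matPos L *ᵥ ψd b a + matNeg L *ᵥ ψd a b

/-- The tight decomposition function at one time of the remainder `g - H·` of `g`. -/
def remainderDecomp {n p : ℕ} (𝒳 : Set (Fin n → ℝ)) (H : Matrix (Fin p) (Fin n) ℝ)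
    (g : (Fin n → ℝ) → (Fin p → ℝ)) (Jg : (Fin n → ℝ) → Matrix (Fin p) (Fin n) ℝ) :
    (Fin n → ℝ) → (Fin n → ℝ) → (Fin p → ℝ) :=
  tightDecomp 𝒳 (fun x => g x - H *ᵥ x) (fun x => Jg x - H)

/-- `(x̄, x̲)` is a solution on `[0, ∞)` of the continuous-time framer system driven by the
output `y`. The interval spanned by `x̲_t` and `x̄_t` has to stay in the domain `𝒳`, on which
alone the decomposition functions are decomposition functions. -/
def IsFramerSolutionCT {n l : ℕ} (𝒳 : Set (Fin n → ℝ)) (A : Matrix (Fin n) (Fin n) ℝ)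
    (C : Matrix (Fin l) (Fin n) ℝ) (L : Matrix (Fin n) (Fin l) ℝ)
    (f : ℝ → (Fin n → ℝ) → (Fin n → ℝ)) (h : ℝ → (Fin n → ℝ) → (Fin l → ℝ))
    (Jf : ℝ → (Fin n → ℝ) → Matrix (Fin n) (Fin n) ℝ)
    (Jh : ℝ → (Fin n → ℝ) → Matrix (Fin l) (Fin n) ℝ)
    (y : ℝ → Fin l → ℝ) (xup xlo : ℝ → Fin n → ℝ) : Prop :=
  ∀ t ∈ Set.Ici (0 : ℝ),
    Set.uIcc (xlo t) (xup t) ⊆ 𝒳 ∧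
    HasDerivWithinAt xup
      (framerField (matDiag (A - L * C) + matPos (matOffDiag (A - L * C)))
        (matNeg (matOffDiag (A - L * C))) L (y t)
        (remainderDecomp 𝒳 A (f t) (Jf t)) (remainderDecomp 𝒳 C (h t) (Jh t))
        (xup t) (xlo t)) (Set.Ici 0) t ∧
    HasDerivWithinAt xlo
      (framerField (matDiag (A - L * C) + matPos (matOffDiag (A - L * C)))
        (matNeg (matOffDiag (A - L * C))) L (y t)
        (remainderDecomp 𝒳 A (f t) (Jf t)) (remainderDecomp 𝒳 C (h t) (Jh t))
        (xlo t) (xup t)) (Set.Ici 0) t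

/-- `(x̄, x̲)` is a solution of the discrete-time framer system driven by the output `y`; the
interval spanned by `x̲_t` and `x̄_t` has to stay in the domain `𝒳`. -/
def IsFramerSolutionDT {n l : ℕ} (𝒳 : Set (Fin n → ℝ)) (A : Matrix (Fin n) (Fin n) ℝ)
    (C : Matrix (Fin l) (Fin n) ℝ) (L : Matrix (Fin n) (Fin l) ℝ)
    (f : ℕ → (Fin n → ℝ) → (Fin n → ℝ)) (h : ℕ → (Fin n → ℝ) → (Fin l → ℝ))
    (Jf : ℕ → (Fin n → ℝ) → Matrix (Fin n) (Fin n) ℝ)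
    (Jh : ℕ → (Fin n → ℝ) → Matrix (Fin l) (Fin n) ℝ)
    (y : ℕ → Fin l → ℝ) (xup xlo : ℕ → Fin n → ℝ) : Prop :=
  ∀ t,
    Set.uIcc (xlo t) (xup t) ⊆ 𝒳 ∧
    xup (t + 1) =
      framerField (matPos (A - L * C)) (matNeg (A - L * C)) L (y t)
        (remainderDecomp 𝒳 A (f t) (Jf t)) (remainderDecomp 𝒳 C (h t) (Jh t))
        (xup t) (xlo t) ∧
    xlo (t + 1) =
      framerField (matPos (A - L * C)) (matNeg (A - L * C)) L (y t)
        (remainderDecomp 𝒳 A (f t) (Jf t)) (remainderDecomp 𝒳 C (h t) (Jh t))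
        (xlo t) (xup t)

/-- Correctness of the framers: `x̲_t ≤ x_t ≤ x̄_t` for all `t ∈ 𝕋`. -/
def IsCorrectFramer {T : Type} {n : ℕ} (𝕋 : Set T) (x xup xlo : T → Fin n → ℝ) : Prop :=
  ∀ t ∈ 𝕋, xlo t ≤ x t ∧ x t ≤ xup t

/-- Stability of the framers: the framer error `ε_t = x̄_t - x̲_t` satisfies `‖ε_t‖ → 0`. -/
def IsStableFramer {T : Type} [Preorder T] {n : ℕ} (xup xlo : T → Fin n → ℝ) : Prop :=
  Filter.Tendsto (fun t => ‖xup t - xlo t‖) Filter.atTop (𝓝 0)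

/-! ## The linear matrix inequalities and the gain -/

/-- Continuous-time conditions, for the scalar parameter `α`. -/
def ConditionsCT {n l : ℕ} (α : ℝ) (A : Matrix (Fin n) (Fin n) ℝ) (C : Matrix (Fin l) (Fin n) ℝ)
    (Fφ : Matrix (Fin n) (Fin n) ℝ) (Fψ : Matrix (Fin l) (Fin n) ℝ)
    (P X : Matrix (Fin n) (Fin n) ℝ) (J : Matrix (Fin l) (Fin n) ℝ) : Prop :=
  let Ω := ((matMetzlerization A)ᵀ + Fφᵀ) * X + Xᵀ * (matMetzlerization A + Fφ)
    + (Cᵀ - Fψᵀ) * J + Jᵀ * (C - Fψ)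
  let Λ := P + α • (((matMetzlerization A)ᵀ + Fφᵀ) * X) + α • ((Cᵀ - Fψᵀ) * J)
  IsNegDef (Matrix.fromBlocks Ω Λ Λᵀ (-(α • (X + Xᵀ)))) ∧ IsMetzler (Jᵀ * C) ∧ X.IsDiag

/-- Discrete-time conditions. -/
def ConditionsDT {n l : ℕ} (A : Matrix (Fin n) (Fin n) ℝ) (C : Matrix (Fin l) (Fin n) ℝ)
    (Fφ : Matrix (Fin n) (Fin n) ℝ) (Fψ : Matrix (Fin l) (Fin n) ℝ)
    (P X : Matrix (Fin n) (Fin n) ℝ) (J : Matrix (Fin l) (Fin n) ℝ) : Prop :=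
  let Γ := ((matAbs A)ᵀ + Fφᵀ) * X - ((matAbs C)ᵀ + Fψᵀ) * J
  IsNegDef (Matrix.fromBlocks (-P) Γ Γᵀ (P - X - Xᵀ)) ∧ IsNonposMatrix (Jᵀ * C) ∧ IsMetzler (-X)

/-- The gain `L = -(Xᵀ)⁻¹ Jᵀ`. -/
def gain {n l : ℕ} (X : Matrix (Fin n) (Fin n) ℝ) (J : Matrix (Fin l) (Fin n) ℝ) :
    Matrix (Fin n) (Fin l) ℝ :=
  -((Xᵀ)⁻¹ * Jᵀ)

end

/-! The lower right block of the LMI, with `P ≻ 0` in discrete time, makes the quadratic form of `X`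
positive, so `X` is invertible. As `X` also has nonpositive off-diagonal entries, `Xᵀ` is inverse
nonnegative, and `J ≤ 0` gives `L ≥ 0` (`gain_nonneg`). Hence `L⁺ = L` and `L⁻ = 0`.

Correctness: for every `v` in the framer box, the field at the upper framer exceeds `f v - L (h v -
y)` up to terms governed by `M↑`, `M↓` and an error proportional to how far the framers are out of
order; the lower framer is symmetric (`le_framerField_sub`, `le_sub_framerField`). In discrete time,
induction with `v = x` suffices. In continuous time the order is not known beforehand: `v` is the
projection of `x` to the box, the local Lipschitz property passes from `v` to `x`, and the squared
violation obeys a Grönwall inequality (`exists_framerField_gap_bound`, `nonneg_of_deriv_ge`). This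
holds on short intervals, and continuous induction extends it.

Stability: once ordered, the error satisfies `ε⁺ ≤ N ε`. Since `Xᵀ L = -Jᵀ`, the LMI is a Lyapunov
condition for `N`. In continuous time `Ω = Nᵀ X + Xᵀ N`, and the diagonal `X` gives the Lyapunov
function `∑ Xᵢᵢ εᵢ²`. In discrete time, testing on `(v, N v)` eliminates `X` and leaves `Nᵀ P N ≺
P`; as `N ≥ 0`, the error lies below a convergent linear iteration. -/

/-! ### Entrywise order and matrix parts -/

theorem mulVec_mono_right {m n : ℕ} {N : Matrix (Fin m) (Fin n) ℝ} (hN : ∀ i j, 0 ≤ N i j)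
    {v w : Fin n → ℝ} (h : v ≤ w) : N *ᵥ v ≤ N *ᵥ w := by
  intro i
  simp only [Matrix.mulVec, dotProduct]
  exact Finset.sum_le_sum fun j _ => mul_le_mul_of_nonneg_left (h j) (hN i j)

theorem mulVec_mono_left {m n : ℕ} {N N' : Matrix (Fin m) (Fin n) ℝ} (hN : ∀ i j, N i j ≤ N' i j)
    {v : Fin n → ℝ} (h : 0 ≤ v) : N *ᵥ v ≤ N' *ᵥ v := by
  intro i
  simp only [Matrix.mulVec, dotProduct]
  exact Finset.sum_le_sum fun j _ => mul_le_mul_of_nonneg_right (hN i j) (h j)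

theorem matPos_eq_self {m n : ℕ} {L : Matrix (Fin m) (Fin n) ℝ} (hL : ∀ i j, 0 ≤ L i j) :
    matPos L = L := by
  ext i j
  simp [matPos, hL i j]

theorem matNeg_eq_zero {m n : ℕ} {L : Matrix (Fin m) (Fin n) ℝ} (hL : ∀ i j, 0 ≤ L i j) :
    matNeg L = 0 := by
  simp [matNeg, matPos_eq_self hL]

theorem matPos_nonneg {m n : ℕ} (M : Matrix (Fin m) (Fin n) ℝ) (i j) : 0 ≤ matPos M i j :=
  le_max_right _ _

theorem matNeg_nonneg {m n : ℕ} (M : Matrix (Fin m) (Fin n) ℝ) (i j) : 0 ≤ matNeg M i j :=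
  sub_nonneg.2 (le_max_left _ _)

theorem matPos_sub_matNeg {m n : ℕ} (M : Matrix (Fin m) (Fin n) ℝ) : matPos M - matNeg M = M := by
  simp [matNeg]

theorem matAbs_apply {m n : ℕ} (M : Matrix (Fin m) (Fin n) ℝ) (i j) :
    matAbs M i j = |M i j| := by
  simp only [matAbs, matNeg, matPos, Matrix.add_apply, Matrix.sub_apply, Matrix.of_apply]
  rcases le_total (M i j) 0 with h | h
  · rw [max_eq_right h, abs_of_nonpos h]; ring
  · rw [max_eq_left h, abs_of_nonneg h]; ring

theorem matOffDiag_apply {n : ℕ} (M : Matrix (Fin n) (Fin n) ℝ) (i j) :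
    matOffDiag M i j = if i = j then 0 else M i j := by
  by_cases h : i = j
  · subst h; simp [matOffDiag, matDiag]
  · simp [matOffDiag, matDiag, h]

/-! ### Tight decomposition functions on possibly unordered boxes -/

/-- The mean value theorem on a box, for one component of a map with a given Jacobian. -/
theorem exists_jacobian_eq_of_uIcc_subset {n p : ℕ} {𝒳 : Set (Fin n → ℝ)}
    {μ : (Fin n → ℝ) → (Fin p → ℝ)} {Jμ : (Fin n → ℝ) → Matrix (Fin p) (Fin n) ℝ}
    (hd : ∀ x ∈ 𝒳, HasFDerivWithinAt μ
      (LinearMap.toContinuousLinearMap (Matrix.toLin' (Jμ x))) 𝒳 x)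
    {a b v w : Fin n → ℝ} (hab : Set.uIcc a b ⊆ 𝒳) (hv : v ∈ Set.uIcc a b)
    (hw : w ∈ Set.uIcc a b) (i : Fin p) :
    ∃ ξ ∈ 𝒳, μ w i - μ v i = ∑ j, Jμ ξ i j * (w j - v j) := by
  -- Convexity comes from the box, since `𝒳` itself is not assumed convex.
  have hconv : Convex ℝ (Set.uIcc a b) := convex_Icc (a ⊓ b) (a ⊔ b)
  obtain ⟨ξ, hξ, h⟩ := domain_mvt (s := Set.uIcc a b) (f := fun x => μ x i)
    (fun x hx => ((hasFDerivWithinAt_pi'.1 ((hd x (hab hx)).mono hab)) i)) hconv hv hw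
  refine ⟨ξ, hab (hconv.segment_subset hv hw hξ), ?_⟩
  rw [h]
  simp [Matrix.mulVec, dotProduct]

section Decomposition

variable {n p : ℕ} {𝒳 : Set (Fin n → ℝ)} {μ : (Fin n → ℝ) → (Fin p → ℝ)}
  {Jμ : (Fin n → ℝ) → Matrix (Fin p) (Fin n) ℝ} {F : Matrix (Fin p) (Fin n) ℝ}

open Classical in
theorem vertex_mem_uIcc (q : Fin n → Prop) (a b : Fin n → ℝ) :
    (fun j => if q j then a j else b j) ∈ Set.uIcc a b := by
  rw [← Set.pi_univ_uIcc]
  intro j _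
  by_cases h : q j <;> simp [h]

theorem IsJSS.nonpos_of_not (hs : IsJSS 𝒳 Jμ) {i j} (h : ¬ ∀ x ∈ 𝒳, 0 ≤ Jμ x i j) :
    ∀ x ∈ 𝒳, Jμ x i j ≤ 0 := (hs i j).resolve_left h

/-- For `b ≤ a` the vertex chosen by the Jacobian signs maximizes `μ i` on the box and the last term
vanishes. A coordinate with `a j < b j` makes the wrong choice, at a cost of at most `F i j * (b j -
a j)`. -/
theorem le_tightDecomp_add
    (hd : ∀ x ∈ 𝒳, HasFDerivWithinAt μ
      (LinearMap.toContinuousLinearMap (Matrix.toLin' (Jμ x))) 𝒳 x)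
    (hF : ∀ x ∈ 𝒳, ∀ i j, |Jμ x i j| ≤ F i j) (hs : IsJSS 𝒳 Jμ)
    {a b v : Fin n → ℝ} (hab : Set.uIcc a b ⊆ 𝒳) (hv : v ∈ Set.uIcc a b) :
    μ v ≤ tightDecomp 𝒳 μ Jμ a b + F *ᵥ ((b - a) ⊔ 0) := by
  intro i
  obtain ⟨ξ, hξ, h⟩ := exists_jacobian_eq_of_uIcc_subset hd hab hv
    (vertex_mem_uIcc (fun j => ∀ x ∈ 𝒳, 0 ≤ Jμ x i j) a b) i
  rw [← Set.pi_univ_uIcc] at hv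
  simp only [tightDecomp, Pi.add_apply, Matrix.mulVec, dotProduct]
  rw [← sub_le_iff_le_add', ← neg_sub, h, neg_le, ← Finset.sum_neg_distrib]
  refine Finset.sum_le_sum fun j _ => ?_
  have hb := abs_le.1 (hF ξ hξ i j)
  have hvj := Set.mem_uIcc.1 (hv j trivial)
  simp only [Pi.sup_apply, Pi.sub_apply, Pi.zero_apply]
  have h0 : 0 ≤ (b j - a j) ⊔ 0 := le_sup_right
  have h1 : b j - a j ≤ (b j - a j) ⊔ 0 := le_sup_left
  generalize (b j - a j) ⊔ 0 = r at h0 h1 ⊢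
  split_ifs with hD
  · have hJ := hD ξ hξ
    have : -r ≤ a j - v j := by rcases hvj with h | h <;> linarith
    nlinarith
  · have hJ := hs.nonpos_of_not hD ξ hξ
    have : b j - v j ≤ r := by rcases hvj with h | h <;> linarith
    nlinarith

theorem tightDecomp_swap_le_add
    (hd : ∀ x ∈ 𝒳, HasFDerivWithinAt μ
      (LinearMap.toContinuousLinearMap (Matrix.toLin' (Jμ x))) 𝒳 x)
    (hF : ∀ x ∈ 𝒳, ∀ i j, |Jμ x i j| ≤ F i j) (hs : IsJSS 𝒳 Jμ)
    {a b v : Fin n → ℝ} (hab : Set.uIcc a b ⊆ 𝒳) (hv : v ∈ Set.uIcc a b) :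
    tightDecomp 𝒳 μ Jμ b a ≤ μ v + F *ᵥ ((b - a) ⊔ 0) := by
  intro i
  obtain ⟨ξ, hξ, h⟩ := exists_jacobian_eq_of_uIcc_subset hd hab hv
    (Set.uIcc_comm b a ▸ vertex_mem_uIcc (fun j => ∀ x ∈ 𝒳, 0 ≤ Jμ x i j) b a) i
  rw [← Set.pi_univ_uIcc] at hv
  simp only [tightDecomp, Pi.add_apply, Matrix.mulVec, dotProduct]
  rw [← sub_le_iff_le_add', h]
  refine Finset.sum_le_sum fun j _ => ?_
  have hb := abs_le.1 (hF ξ hξ i j)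
  have hvj := Set.mem_uIcc.1 (hv j trivial)
  simp only [Pi.sup_apply, Pi.sub_apply, Pi.zero_apply]
  have h0 : 0 ≤ (b j - a j) ⊔ 0 := le_sup_right
  have h1 : b j - a j ≤ (b j - a j) ⊔ 0 := le_sup_left
  generalize (b j - a j) ⊔ 0 = r at h0 h1 ⊢
  split_ifs with hD
  · have hJ := hD ξ hξ
    have : b j - v j ≤ r := by rcases hvj with h | h <;> linarith
    nlinarith
  · have hJ := hs.nonpos_of_not hD ξ hξ
    have : -r ≤ a j - v j := by rcases hvj with h | h <;> linarith
    nlinarith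

/-- The two opposite vertices differ by `±(a j - b j)` in coordinate `j`, so the mean value theorem
and the Jacobian bound suffice, whatever the signs. -/
theorem tightDecomp_sub_swap_le
    (hd : ∀ x ∈ 𝒳, HasFDerivWithinAt μ
      (LinearMap.toContinuousLinearMap (Matrix.toLin' (Jμ x))) 𝒳 x)
    (hF : ∀ x ∈ 𝒳, ∀ i j, |Jμ x i j| ≤ F i j)
    {a b : Fin n → ℝ} (hab : Set.uIcc a b ⊆ 𝒳) (hle : b ≤ a) :
    tightDecomp 𝒳 μ Jμ a b - tightDecomp 𝒳 μ Jμ b a ≤ F *ᵥ (a - b) := by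
  intro i
  obtain ⟨ξ, hξ, h⟩ := exists_jacobian_eq_of_uIcc_subset hd hab
    (Set.uIcc_comm b a ▸ vertex_mem_uIcc (fun j => ∀ x ∈ 𝒳, 0 ≤ Jμ x i j) b a)
    (vertex_mem_uIcc (fun j => ∀ x ∈ 𝒳, 0 ≤ Jμ x i j) a b) i
  simp only [tightDecomp, Pi.sub_apply, Matrix.mulVec, dotProduct]
  rw [h]
  refine Finset.sum_le_sum fun j _ => ?_
  have hb := abs_le.1 (hF ξ hξ i j)
  have hj := hle j
  split_ifs with hD <;> nlinarith

end Decomposition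

/-! ### Remainders of the plant maps and bounds on the framer field -/

/-- An entry of a matrix between `Jlo - H` and `Jup - H` is bounded by the width bound. -/
theorem abs_sub_le_widthBound {n p : ℕ} {Jlo Jup H M : Matrix (Fin p) (Fin n) ℝ} {i j}
    (hlo : Jlo i j ≤ M i j) (hup : M i j ≤ Jup i j) :
    |(M - H) i j| ≤ widthBound Jlo Jup H i j := by
  simp only [widthBound, matPos, Matrix.add_apply, Matrix.sub_apply, Matrix.smul_apply,
    Matrix.of_apply, smul_eq_mul]
  have h0 := le_max_right (Jup i j - H i j) 0
  have h1 := le_max_left (Jup i j - H i j) 0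
  rw [abs_le]
  constructor <;> linarith

theorem hasFDerivWithinAt_sub_mulVec {n p : ℕ} {𝒳 : Set (Fin n → ℝ)} {x : Fin n → ℝ}
    {g : (Fin n → ℝ) → (Fin p → ℝ)} {Jg : Matrix (Fin p) (Fin n) ℝ}
    (H : Matrix (Fin p) (Fin n) ℝ)
    (hg : HasFDerivWithinAt g (LinearMap.toContinuousLinearMap (Matrix.toLin' Jg)) 𝒳 x) :
    HasFDerivWithinAt (fun x => g x - H *ᵥ x)
      (LinearMap.toContinuousLinearMap (Matrix.toLin' (Jg - H))) 𝒳 x := by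
  have := hg.sub (LinearMap.toContinuousLinearMap (Matrix.toLin' H)).hasFDerivWithinAt
  rw [map_sub, map_sub]
  exact this

/-- The data of a plant map at one time: its Jacobian lies in `[Jlo, Jup]` on `𝒳`, and the
remainder `g - H·` is Jacobian sign-stable. -/
structure HasJSSRemainder {n p : ℕ} (𝒳 : Set (Fin n → ℝ)) (H : Matrix (Fin p) (Fin n) ℝ)
    (g : (Fin n → ℝ) → (Fin p → ℝ)) (Jg : (Fin n → ℝ) → Matrix (Fin p) (Fin n) ℝ)
    (F : Matrix (Fin p) (Fin n) ℝ) : Prop where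
  hasFDeriv : ∀ x ∈ 𝒳, HasFDerivWithinAt (fun x => g x - H *ᵥ x)
      (LinearMap.toContinuousLinearMap (Matrix.toLin' (Jg x - H))) 𝒳 x
  abs_le : ∀ x ∈ 𝒳, ∀ i j, |(Jg x - H) i j| ≤ F i j
  jss : IsJSS 𝒳 fun x => Jg x - H

theorem HasBoundedJacobian.hasJSSRemainder {T : Type} [TopologicalSpace T] {n p : ℕ}
    {𝕋 : Set T} {𝒳 : Set (Fin n → ℝ)} {g : T → (Fin n → ℝ) → (Fin p → ℝ)}
    {Jg : T → (Fin n → ℝ) → Matrix (Fin p) (Fin n) ℝ} {Jlo Jup H : Matrix (Fin p) (Fin n) ℝ}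
    (hg : HasBoundedJacobian 𝕋 𝒳 g Jg Jlo Jup) {t : T} (ht : t ∈ 𝕋)
    (hs : IsJSS 𝒳 fun x => Jg t x - H) :
    HasJSSRemainder 𝒳 H (g t) (Jg t) (widthBound Jlo Jup H) where
  hasFDeriv x hx := hasFDerivWithinAt_sub_mulVec H (hg.hasJacobian t ht x hx)
  abs_le x hx i j := abs_sub_le_widthBound (hg.lower_le t ht x hx i j) (hg.le_upper t ht x hx i j)
  jss := hs

section Framer

variable {n l : ℕ} {𝒳 : Set (Fin n → ℝ)} {A Mup Mdown Fφ : Matrix (Fin n) (Fin n) ℝ}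
  {C Fψ : Matrix (Fin l) (Fin n) ℝ} {L : Matrix (Fin n) (Fin l) ℝ}
  {f : (Fin n → ℝ) → (Fin n → ℝ)} {h : (Fin n → ℝ) → (Fin l → ℝ)}
  {Jf : (Fin n → ℝ) → Matrix (Fin n) (Fin n) ℝ} {Jh : (Fin n → ℝ) → Matrix (Fin l) (Fin n) ℝ}

theorem framerField_of_nonneg (hL : ∀ i j, 0 ≤ L i j) (y : Fin l → ℝ)
    (φd : (Fin n → ℝ) → (Fin n → ℝ) → (Fin n → ℝ))
    (ψd : (Fin n → ℝ) → (Fin n → ℝ) → (Fin l → ℝ)) (a b : Fin n → ℝ) :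
    framerField Mup Mdown L y φd ψd a b =
      Mup *ᵥ a - Mdown *ᵥ b + L *ᵥ y + φd a b - L *ᵥ ψd b a := by
  simp [framerField, matPos_eq_self hL, matNeg_eq_zero hL]

/-- At `v` the linear part `(M↑ - M↓) v = A v - L C v` recombines with the remainders into `f v - L
(h v)`. The `ψ` term enters with a minus sign and swapped arguments, so `L ≥ 0` preserves the
direction of its bound. -/
theorem le_framerField_sub (hf : HasJSSRemainder 𝒳 A f Jf Fφ) (hh : HasJSSRemainder 𝒳 C h Jh Fψ)
    (hL : ∀ i j, 0 ≤ L i j) (hM : Mup - Mdown = A - L * C) {a b v : Fin n → ℝ}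
    (hab : Set.uIcc a b ⊆ 𝒳) (hv : v ∈ Set.uIcc a b) (x : Fin n → ℝ) :
    Mup *ᵥ (a - v) + Mdown *ᵥ (v - b) + (f v - f x) - L *ᵥ (h v - h x)
        - (Fφ + L * Fψ) *ᵥ ((b - a) ⊔ 0) ≤
      framerField Mup Mdown L (h x) (remainderDecomp 𝒳 A f Jf) (remainderDecomp 𝒳 C h Jh) a b
        - f x := by
  have h1 := le_tightDecomp_add hf.hasFDeriv hf.abs_le hf.jss hab hv
  have h2 := mulVec_mono_right hL
    (tightDecomp_swap_le_add hh.hasFDeriv hh.abs_le hh.jss hab hv)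
  have h3 : Mup *ᵥ v - Mdown *ᵥ v = A *ᵥ v - L *ᵥ (C *ᵥ v) := by
    rw [← Matrix.sub_mulVec, hM, Matrix.sub_mulVec, Matrix.mulVec_mulVec]
  rw [framerField_of_nonneg hL]
  intro i
  have h1 := h1 i
  have h2 := h2 i
  have h3 := congrFun h3 i
  simp only [remainderDecomp, Matrix.mulVec_sub, Matrix.mulVec_add, Matrix.add_mulVec,
    ← Matrix.mulVec_mulVec, Pi.add_apply, Pi.sub_apply] at h1 h2 h3 ⊢
  linarith

theorem le_sub_framerField (hf : HasJSSRemainder 𝒳 A f Jf Fφ) (hh : HasJSSRemainder 𝒳 C h Jh Fψ)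
    (hL : ∀ i j, 0 ≤ L i j) (hM : Mup - Mdown = A - L * C) {a b v : Fin n → ℝ}
    (hab : Set.uIcc a b ⊆ 𝒳) (hv : v ∈ Set.uIcc a b) (x : Fin n → ℝ) :
    Mup *ᵥ (v - b) + Mdown *ᵥ (a - v) + (f x - f v) - L *ᵥ (h x - h v)
        - (Fφ + L * Fψ) *ᵥ ((b - a) ⊔ 0) ≤
      f x -
        framerField Mup Mdown L (h x) (remainderDecomp 𝒳 A f Jf) (remainderDecomp 𝒳 C h Jh)
          b a := by
  have h1 := tightDecomp_swap_le_add hf.hasFDeriv hf.abs_le hf.jss hab hv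
  have h2 := mulVec_mono_right hL
    (le_tightDecomp_add hh.hasFDeriv hh.abs_le hh.jss hab hv)
  have h3 : Mup *ᵥ v - Mdown *ᵥ v = A *ᵥ v - L *ᵥ (C *ᵥ v) := by
    rw [← Matrix.sub_mulVec, hM, Matrix.sub_mulVec, Matrix.mulVec_mulVec]
  rw [framerField_of_nonneg hL]
  intro i
  have h1 := h1 i
  have h2 := h2 i
  have h3 := congrFun h3 i
  simp only [remainderDecomp, Matrix.mulVec_sub, Matrix.mulVec_add, Matrix.add_mulVec,
    ← Matrix.mulVec_mulVec, Pi.add_apply, Pi.sub_apply] at h1 h2 h3 ⊢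
  linarith

/-- The output term cancels in the difference, and `M↓` enters with a plus sign because the
arguments are exchanged. -/
theorem framerField_sub_swap_le (hf : HasJSSRemainder 𝒳 A f Jf Fφ)
    (hh : HasJSSRemainder 𝒳 C h Jh Fψ) (hL : ∀ i j, 0 ≤ L i j) (y : Fin l → ℝ)
    {a b : Fin n → ℝ} (hab : Set.uIcc a b ⊆ 𝒳) (hle : b ≤ a) :
    framerField Mup Mdown L y (remainderDecomp 𝒳 A f Jf) (remainderDecomp 𝒳 C h Jh) a b
      - framerField Mup Mdown L y (remainderDecomp 𝒳 A f Jf) (remainderDecomp 𝒳 C h Jh) b a ≤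
    (Mup + Mdown + Fφ + L * Fψ) *ᵥ (a - b) := by
  have h1 := tightDecomp_sub_swap_le hf.hasFDeriv hf.abs_le hab hle
  have h2 := mulVec_mono_right hL (tightDecomp_sub_swap_le hh.hasFDeriv hh.abs_le hab hle)
  rw [framerField_of_nonneg hL, framerField_of_nonneg hL]
  intro i
  have h1 := h1 i
  have h2 := h2 i
  simp only [remainderDecomp, Matrix.mulVec_sub, Matrix.add_mulVec,
    ← Matrix.mulVec_mulVec, Pi.add_apply, Pi.sub_apply] at h1 h2 ⊢
  linarith

end Framer

/-! ### Differential inequalities and invariance of the orthant -/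

/-- The first-order Taylor remainder at `s` is at most `(z - s) ^ 2` in absolute value, also across
the kink at zero. -/
theorem hasDerivAt_max_zero_sq (s : ℝ) :
    HasDerivAt (fun z : ℝ => (max z 0) ^ 2) (2 * max s 0) s := by
  rw [hasDerivAt_iff_isLittleO]
  refine Asymptotics.IsBigO.trans_isLittleO (g := fun z => (z - s) ^ 2) ?_ ?_
  · refine Asymptotics.IsBigO.of_bound 1 (Filter.Eventually.of_forall fun z => ?_)
    rw [one_mul, Real.norm_eq_abs, Real.norm_eq_abs, abs_of_nonneg (sq_nonneg (z - s)), abs_le,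
      smul_eq_mul]
    rcases le_total z 0 with hz | hz <;> rcases le_total s 0 with hs | hs <;>
      simp only [hz, hs, max_eq_left, max_eq_right] <;> constructor <;> nlinarith [sq_nonneg (z - s)]
  · have h : (fun z : ℝ => z - s) =o[𝓝 s] fun _ => (1 : ℝ) := by
      rw [Asymptotics.isLittleO_one_iff]
      exact (continuous_sub_right s).tendsto' _ _ (sub_self s)
    simpa [sq] using h.mul_isBigO (Asymptotics.isBigO_refl (fun z : ℝ => z - s) (𝓝 s))

/-- Scalar Grönwall inequality for a differentiable function. -/
theorem le_mul_exp_of_deriv_le {V V' : ℝ → ℝ} {K a b : ℝ} (hV : ContinuousOn V (Set.Icc a b))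
    (hV' : ∀ t ∈ Set.Ico a b, HasDerivWithinAt V (V' t) (Set.Ici t) t)
    (hle : ∀ t ∈ Set.Ico a b, V' t ≤ K * V t) :
    ∀ t ∈ Set.Icc a b, V t ≤ V a * Real.exp (K * (t - a)) := by
  intro t ht
  rw [← gronwallBound_ε0]
  refine le_gronwallBound_of_liminf_deriv_right_le (f' := V') hV (fun x hx r hr => ?_) le_rfl
    (fun x hx => by simpa using hle x hx) t ht
  simpa [slope, vsub_eq_sub] using (hV' x hx).liminf_right_slope_le hr

/-- Positive invariance of the nonnegative orthant: a curve `e` starting in the orthant stays there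
if its velocity in each violated coordinate is at least `-K` times the total violation. -/
theorem nonneg_of_deriv_ge {ι : Type*} [Fintype ι] {e e' : ℝ → ι → ℝ} {K a b : ℝ} (hK : 0 ≤ K)
    (hc : ContinuousOn e (Set.Icc a b))
    (he : ∀ t ∈ Set.Ico a b, HasDerivWithinAt e (e' t) (Set.Ici t) t)
    (h0 : 0 ≤ e a)
    (hle : ∀ t ∈ Set.Ico a b, ∀ i, e t i < 0 → -(K * ∑ j, max (-e t j) 0) ≤ e' t i) :
    ∀ t ∈ Set.Icc a b, 0 ≤ e t := by
  -- Squaring makes the negative parts differentiable, so Grönwall applies to `V`, which starts at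
  -- zero.
  set V : ℝ → ℝ := fun t => ∑ i, (max (-e t i) 0) ^ 2 with hVdef
  have hVc : ContinuousOn V (Set.Icc a b) := by
    refine continuousOn_finsetSum _ fun i _ => ?_
    have := continuousOn_pi.1 hc i
    fun_prop
  have hVd : ∀ t ∈ Set.Ico a b, HasDerivWithinAt V
      (∑ i, 2 * max (-e t i) 0 * -e' t i) (Set.Ici t) t := by
    intro t ht
    refine HasDerivWithinAt.fun_sum fun i _ => ?_
    exact (hasDerivAt_max_zero_sq (-e t i)).comp_hasDerivWithinAt t
      ((hasDerivWithinAt_pi.1 (he t ht) i).neg)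
  have hVle : ∀ t ∈ Set.Ico a b, ∑ i, 2 * max (-e t i) 0 * -e' t i ≤
      (2 * K * Fintype.card ι) * V t := by
    intro t ht
    set S := ∑ j, max (-e t j) 0 with hS
    have h1 : ∑ i, 2 * max (-e t i) 0 * -e' t i ≤ ∑ i, 2 * max (-e t i) 0 * (K * S) := by
      refine Finset.sum_le_sum fun i _ => ?_
      rcases lt_or_ge (e t i) 0 with h | h
      · exact mul_le_mul_of_nonneg_left (by linarith [hle t ht i h]) (by positivity)
      · rw [max_eq_right (by linarith)]; simp
    have h2 : ∑ i, 2 * max (-e t i) 0 * (K * S) = 2 * K * S ^ 2 := by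
      rw [← Finset.sum_mul, ← Finset.mul_sum, ← hS]; ring
    -- Cauchy–Schwarz turns the squared total violation back into `V`.
    have h3 : S ^ 2 ≤ Fintype.card ι * V t := sq_sum_le_card_mul_sum_sq
    nlinarith
  have hVa : V a = 0 := by
    refine Finset.sum_eq_zero fun i _ => ?_
    have := h0 i
    rw [max_eq_right (by simpa using this)]; simp
  intro t ht i
  have hVt := le_mul_exp_of_deriv_le hVc hVd hVle t ht
  rw [hVa, zero_mul] at hVt
  have h1 : (max (-e t i) 0) ^ 2 ≤ V t :=
    Finset.single_le_sum (f := fun i => (max (-e t i) 0) ^ 2) (fun _ _ => sq_nonneg _)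
      (Finset.mem_univ i)
  have h2 : max (-e t i) 0 = 0 := pow_eq_zero_iff (two_ne_zero) |>.1
    (le_antisymm (h1.trans hVt) (sq_nonneg _))
  have := max_eq_right_iff.1 h2
  simpa using this

theorem exists_abs_mulVec_le {m n : ℕ} (N : Matrix (Fin m) (Fin n) ℝ) :
    ∃ K : ℝ, 0 ≤ K ∧ ∀ (v : Fin n → ℝ) (S : ℝ), (∀ j, |v j| ≤ S) → ∀ i, |(N *ᵥ v) i| ≤ K * S := by
  refine ⟨∑ i, ∑ j, |N i j|, by positivity, fun v S hv i => ?_⟩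
  by_cases hn : Nonempty (Fin n)
  · have hS : 0 ≤ S := (abs_nonneg _).trans (hv hn.some)
    calc |(N *ᵥ v) i| ≤ ∑ j, |N i j * v j| := by
          simp only [Matrix.mulVec, dotProduct]
          exact Finset.abs_sum_le_sum_abs _ _
      _ ≤ ∑ j, |N i j| * S := Finset.sum_le_sum fun j _ => by
          rw [abs_mul]; exact mul_le_mul_of_nonneg_left (hv j) (abs_nonneg _)
      _ = (∑ j, |N i j|) * S := (Finset.sum_mul ..).symm
      _ ≤ _ := mul_le_mul_of_nonneg_right (Finset.single_le_sum
          (f := fun i => ∑ j, |N i j|) (fun _ _ => by positivity) (Finset.mem_univ i)) hS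
  · rw [not_nonempty_iff] at hn
    simp [Matrix.mulVec, dotProduct]

/-- A lower bound for the velocity of the framer in a coordinate `i` with `α i ≤ 0`, in terms of a
common bound `S` on all violations. -/
theorem exists_neg_mul_le_of_isMetzler {n l : ℕ} {Mup Mdown : Matrix (Fin n) (Fin n) ℝ}
    (hup : IsMetzler Mup) (hdown : ∀ i j, 0 ≤ Mdown i j) (L : Matrix (Fin n) (Fin l) ℝ)
    (N : Matrix (Fin n) (Fin n) ℝ) :
    ∃ K : ℝ, 0 ≤ K ∧ ∀ (α β δ v : Fin n → ℝ) (η : Fin l → ℝ) (S : ℝ) (i : Fin n),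
      (∀ j, -S ≤ α j) → α i ≤ 0 → (∀ j, -S ≤ β j) → (∀ j, |δ j| ≤ S) → (∀ j, |η j| ≤ S) →
      (∀ j, |v j| ≤ S) →
      -(K * S) ≤ (Mup *ᵥ α + Mdown *ᵥ β + δ - L *ᵥ η - N *ᵥ v) i := by
  obtain ⟨K1, hK1, h1⟩ := exists_abs_mulVec_le Mup
  obtain ⟨K2, hK2, h2⟩ := exists_abs_mulVec_le Mdown
  obtain ⟨K3, hK3, h3⟩ := exists_abs_mulVec_le L
  obtain ⟨K4, hK4, h4⟩ := exists_abs_mulVec_le N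
  refine ⟨K1 + K2 + 1 + K3 + K4, by positivity, fun α β δ v η S i hα hαi hβ hδ hη hv => ?_⟩
  have hS : 0 ≤ S := (abs_nonneg _).trans (hδ i)
  have htrunc : ∀ w : Fin n → ℝ, (∀ j, -S ≤ w j) → ∀ j, |(w ⊓ 0) j| ≤ S := by
    intro w hw j
    have h : (w ⊓ 0) j ≤ 0 := by simp
    rw [abs_of_nonpos h, neg_le, Pi.inf_apply]
    exact le_inf (hw j) (by simpa using hS)
  -- `α` is bounded only from below. Truncation discards positive entries, which helps off the
  -- diagonal by the Metzler property; on the diagonal `α i ≤ 0` means nothing is lost, whatever the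
  -- sign of `Mup i i`.
  have e1 : (Mup *ᵥ (α ⊓ 0)) i ≤ (Mup *ᵥ α) i := by
    simp only [Matrix.mulVec, dotProduct]
    refine Finset.sum_le_sum fun j _ => ?_
    by_cases hij : i = j
    · subst hij; simp [hαi]
    · exact mul_le_mul_of_nonneg_left (by simp) (hup i j hij)
  have e2 : (Mdown *ᵥ (β ⊓ 0)) i ≤ (Mdown *ᵥ β) i := mulVec_mono_right hdown inf_le_left i
  have b1 := abs_le.1 (h1 _ S (htrunc α hα) i)
  have b2 := abs_le.1 (h2 _ S (htrunc β hβ) i)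
  have b3 := abs_le.1 (h3 _ S hη i)
  have b4 := abs_le.1 (h4 _ S hv i)
  have b5 := abs_le.1 (hδ i)
  simp only [Pi.add_apply, Pi.sub_apply]
  linarith

/-! ### Projection to the framer box and correctness -/

/-- The point of the box spanned by `a` and `b` which is closest to `x`. -/
noncomputable def boxClamp {n : ℕ} (a b x : Fin n → ℝ) : Fin n → ℝ :=
  (a ⊓ b) ⊔ (x ⊓ (a ⊔ b))

theorem boxClamp_mem {n : ℕ} (a b x : Fin n → ℝ) : boxClamp a b x ∈ Set.uIcc a b :=
  ⟨le_sup_left, sup_le inf_le_sup inf_le_right⟩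

theorem boxClamp_eq_self {n : ℕ} {a b x : Fin n → ℝ} (h1 : b ≤ x) (h2 : x ≤ a) :
    boxClamp a b x = x := by
  rw [boxClamp, inf_eq_right.2 (h1.trans h2), sup_eq_left.2 (h1.trans h2), inf_eq_left.2 h2,
    sup_eq_right.2 h1]

/-- Everything is controlled by the violation `s` in the same coordinate. The last two claims give
the sign condition in the violated coordinate that a Metzler matrix with arbitrary diagonal
requires. -/
theorem boxClamp_coord_bounds (a b x : ℝ) :
    let p := (a ⊓ b) ⊔ (x ⊓ (a ⊔ b))
    let s := max (-(a - x)) 0 + max (-(x - b)) 0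
    |p - x| ≤ s ∧ (b - a) ⊔ 0 ≤ s ∧ -s ≤ a - p ∧ -s ≤ p - b ∧
      (a < x → a ≤ p) ∧ (x < b → p ≤ b) := by
  intro p s
  simp only [p, s, abs_le]
  grind

theorem LipschitzOnWith.abs_sub_apply_le {n p : ℕ} {K : ℝ≥0} {g : (Fin n → ℝ) → (Fin p → ℝ)}
    {U : Set (Fin n → ℝ)} (hg : LipschitzOnWith K g U) {v w : Fin n → ℝ} (hv : v ∈ U) (hw : w ∈ U)
    {S : ℝ} (hS : 0 ≤ S) (h : ∀ j, |v j - w j| ≤ S) (i : Fin p) : |g v i - g w i| ≤ K * S := by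
  have h1 := hg.dist_le_mul v hv w hw
  have h2 : dist v w ≤ S := (dist_pi_le_iff hS).2 h
  exact (dist_le_pi_dist (g v) (g w) i).trans
    (h1.trans (mul_le_mul_of_nonneg_left h2 K.coe_nonneg))

section CorrectnessCT

variable {n l : ℕ} {𝒳 : Set (Fin n → ℝ)} {A Jflo Jfup Mup Mdown : Matrix (Fin n) (Fin n) ℝ}
  {C Jhlo Jhup : Matrix (Fin l) (Fin n) ℝ} {L : Matrix (Fin n) (Fin l) ℝ}
  {f : ℝ → (Fin n → ℝ) → (Fin n → ℝ)} {h : ℝ → (Fin n → ℝ) → (Fin l → ℝ)}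
  {Jf : ℝ → (Fin n → ℝ) → Matrix (Fin n) (Fin n) ℝ}
  {Jh : ℝ → (Fin n → ℝ) → Matrix (Fin l) (Fin n) ℝ} {x xup xlo : ℝ → Fin n → ℝ}

/-- The signed distances of `x` to the upper and to the lower framer. -/
def framerGap (a x b : Fin n → ℝ) : Fin n ⊕ Fin n → ℝ := Sum.elim (a - x) (x - b)

theorem framerGap_nonneg_iff {a x b : Fin n → ℝ} : 0 ≤ framerGap a x b ↔ b ≤ x ∧ x ≤ a := by
  simp only [Pi.le_def, framerGap, Sum.forall, Sum.elim_inl, Sum.elim_inr, Pi.zero_apply,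
    Pi.sub_apply, sub_nonneg]
  exact and_comm

/-- At one time, if `f` and `h` are Lipschitz on a set containing the state and its projection to
the framer box, the velocity of a violated gap is bounded below by the total violation. -/
theorem exists_framerField_gap_bound (Fφ : Matrix (Fin n) (Fin n) ℝ) (Fψ : Matrix (Fin l) (Fin n) ℝ)
    (hL : ∀ i j, 0 ≤ L i j) (hM : Mup - Mdown = A - L * C) (hup : IsMetzler Mup)
    (hdown : ∀ i j, 0 ≤ Mdown i j) (Kf Kh : ℝ≥0) :
    ∃ K : ℝ, 0 ≤ K ∧ ∀ (f : (Fin n → ℝ) → (Fin n → ℝ)) (h : (Fin n → ℝ) → (Fin l → ℝ))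
      (Jf : (Fin n → ℝ) → Matrix (Fin n) (Fin n) ℝ) (Jh : (Fin n → ℝ) → Matrix (Fin l) (Fin n) ℝ)
      (Uf Uh : Set (Fin n → ℝ)) (a b x : Fin n → ℝ),
      HasJSSRemainder 𝒳 A f Jf Fφ → HasJSSRemainder 𝒳 C h Jh Fψ →
      LipschitzOnWith Kf f Uf → LipschitzOnWith Kh h Uh → Set.uIcc a b ⊆ 𝒳 →
      x ∈ Uf → boxClamp a b x ∈ Uf → x ∈ Uh → boxClamp a b x ∈ Uh →
      ∀ i, framerGap a x b i < 0 → -(K * ∑ j, max (-framerGap a x b j) 0) ≤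
        framerGap
          (framerField Mup Mdown L (h x) (remainderDecomp 𝒳 A f Jf) (remainderDecomp 𝒳 C h Jh) a b)
          (f x)
          (framerField Mup Mdown L (h x) (remainderDecomp 𝒳 A f Jf) (remainderDecomp 𝒳 C h Jh) b a)
          i := by
  obtain ⟨K, hK, hbound⟩ := exists_neg_mul_le_of_isMetzler hup hdown L (Fφ + L * Fψ)
  -- The factor yields one common bound for the displacements (`1`) and for the increments of `f`
  -- (`Kf`) and `h` (`Kh`).
  refine ⟨K * (1 + Kf + Kh), by positivity, ?_⟩
  intro f h Jf Jh Uf Uh a b x hf hh hLf hLh hab hxf hpf hxh hph i hi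
  set p := boxClamp a b x with hp
  set T := ∑ j, max (-framerGap a x b j) 0 with hT
  have hT0 : 0 ≤ T := Finset.sum_nonneg fun _ _ => le_max_right _ _
  have hs : ∀ j, max (-(a j - x j)) 0 + max (-(x j - b j)) 0 ≤ T := by
    intro j
    rw [hT, Fintype.sum_sum_type, ← Finset.sum_add_distrib]
    exact Finset.single_le_sum
      (f := fun j => max (-(a j - x j)) 0 + max (-(x j - b j)) 0) (fun _ _ => by positivity)
      (Finset.mem_univ j)
  have hcoord := fun j => boxClamp_coord_bounds (a j) (b j) (x j)
  have hpj : ∀ j, p j = (a j ⊓ b j) ⊔ (x j ⊓ (a j ⊔ b j)) := fun j => rfl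
  simp only [← hpj] at hcoord
  have hpx : ∀ j, |p j - x j| ≤ T := fun j => (hcoord j).1.trans (hs j)
  have hxp : ∀ j, |x j - p j| ≤ T := fun j => by rw [abs_sub_comm]; exact hpx j
  have hTS : T ≤ (1 + Kf + Kh) * T := by nlinarith [Kf.coe_nonneg, Kh.coe_nonneg]
  have hfS : (Kf : ℝ) * T ≤ (1 + Kf + Kh) * T := by nlinarith [Kf.coe_nonneg, Kh.coe_nonneg]
  have hhS : (Kh : ℝ) * T ≤ (1 + Kf + Kh) * T := by nlinarith [Kf.coe_nonneg, Kh.coe_nonneg]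
  have hv : ∀ j, |((b - a) ⊔ 0) j| ≤ (1 + Kf + Kh) * T := fun j => by
    rw [abs_of_nonneg (by simp)]
    exact ((hcoord j).2.1.trans (hs j)).trans hTS
  have hα : ∀ j, -((1 + Kf + Kh) * T) ≤ (a - p) j := fun j => by
    have h1 := (hcoord j).2.2.1
    have h2 := hs j
    simp only [Pi.sub_apply]
    linarith
  have hβ : ∀ j, -((1 + Kf + Kh) * T) ≤ (p - b) j := fun j => by
    have h1 := (hcoord j).2.2.2.1
    have h2 := hs j
    simp only [Pi.sub_apply]
    linarith
  rw [mul_assoc]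
  rcases i with i | i
  · refine (hbound (a - p) (p - b) (f p - f x) ((b - a) ⊔ 0) (h p - h x) ((1 + Kf + Kh) * T) i
      hα ?_ hβ (fun j => ?_) (fun j => ?_) hv).trans
      (le_framerField_sub hf hh hL hM hab (boxClamp_mem a b x) x i)
    · simp only [framerGap, Sum.elim_inl, Pi.sub_apply] at hi
      simpa using (hcoord i).2.2.2.2.1 (by linarith)
    · exact (hLf.abs_sub_apply_le hpf hxf hT0 hpx j).trans hfS
    · exact (hLh.abs_sub_apply_le hph hxh hT0 hpx j).trans hhS
  · refine (hbound (p - b) (a - p) (f x - f p) ((b - a) ⊔ 0) (h x - h p) ((1 + Kf + Kh) * T) i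
      hβ ?_ hα (fun j => ?_) (fun j => ?_) hv).trans
      (le_sub_framerField hf hh hL hM hab (boxClamp_mem a b x) x i)
    · simp only [framerGap, Sum.elim_inr, Pi.sub_apply] at hi
      simpa using (hcoord i).2.2.2.2.2 (by linarith)
    · exact (hLf.abs_sub_apply_le hxf hpf hT0 hxp j).trans hfS
    · exact (hLh.abs_sub_apply_le hxh hph hT0 hxp j).trans hhS

theorem HasDerivWithinAt.framerGap {a b x : ℝ → Fin n → ℝ} {a' b' x' : Fin n → ℝ} {s : Set ℝ}
    {t : ℝ} (ha : HasDerivWithinAt a a' s t) (hx : HasDerivWithinAt x x' s t)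
    (hb : HasDerivWithinAt b b' s t) :
    HasDerivWithinAt (fun t => _root_.framerGap (a t) (x t) (b t))
      (_root_.framerGap a' x' b') s t := by
  rw [hasDerivWithinAt_pi]
  rintro (i | i)
  · exact hasDerivWithinAt_pi.1 (ha.sub hx) i
  · exact hasDerivWithinAt_pi.1 (hx.sub hb) i

theorem IsMetzler.upper (M : Matrix (Fin n) (Fin n) ℝ) :
    IsMetzler (matDiag M + matPos (matOffDiag M)) := by
  intro i j hij
  simp [matDiag, hij, matPos_nonneg]

theorem matDiag_add_matPos_sub_matNeg (M : Matrix (Fin n) (Fin n) ℝ) :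
    matDiag M + matPos (matOffDiag M) - matNeg (matOffDiag M) = M := by
  rw [add_sub_assoc, matPos_sub_matNeg, matOffDiag, add_sub_cancel]

/-- The continuous-time framers bracket the state. -/
theorem isCorrectFramer_ct (hf : HasBoundedJacobian (Set.Ici 0) 𝒳 f Jf Jflo Jfup)
    (hh : HasBoundedJacobian (Set.Ici 0) 𝒳 h Jh Jhlo Jhup)
    (hsf : ∀ t ∈ Set.Ici (0 : ℝ), IsJSS 𝒳 (fun x => Jf t x - A))
    (hsh : ∀ t ∈ Set.Ici (0 : ℝ), IsJSS 𝒳 (fun x => Jh t x - C))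
    (hL : ∀ i j, 0 ≤ L i j) (hx : IsPlantTrajectoryCT 𝒳 f x)
    (h0 : x 0 ∈ Set.Icc (xlo 0) (xup 0))
    (hs : IsFramerSolutionCT 𝒳 A C L f h Jf Jh (fun t => h t (x t)) xup xlo) :
    IsCorrectFramer (Set.Ici 0) x xup xlo := by
  set e : ℝ → Fin n ⊕ Fin n → ℝ := fun t => framerGap (xup t) (x t) (xlo t) with he
  have hxc : ContinuousOn x (Set.Ici 0) := fun t ht => (hx t ht).2.continuousWithinAt
  have huc : ContinuousOn xup (Set.Ici 0) := fun t ht => (hs t ht).2.1.continuousWithinAt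
  have hlc : ContinuousOn xlo (Set.Ici 0) := fun t ht => (hs t ht).2.2.continuousWithinAt
  have hed := fun t ht => (hs t ht).2.1.framerGap (hx t ht).2 (hs t ht).2.2
  have hec : ContinuousOn e (Set.Ici 0) := fun t ht => (hed t ht).continuousWithinAt
  have hpc : ContinuousOn (fun t => boxClamp (xup t) (xlo t) (x t)) (Set.Ici 0) :=
    continuousOn_pi.2 fun j =>
      have hu := continuousOn_pi.1 huc j
      have hl := continuousOn_pi.1 hlc j
      (hu.inf hl).sup ((continuousOn_pi.1 hxc j).inf (hu.sup hl))
  suffices H : ∀ t ∈ Set.Ici (0 : ℝ), 0 ≤ e t from fun t ht => framerGap_nonneg_iff.1 (H t ht)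
  intro T hT
  have hclosed : IsClosed ({t | 0 ≤ e t} ∩ Set.Icc 0 T) := by
    have hec' : ContinuousOn e (Set.Icc 0 T) := hec.mono Set.Icc_subset_Ici_self
    have := hec'.preimage_isClosed_of_isClosed
      isClosed_Icc (isClosed_Ici (a := (0 : Fin n ⊕ Fin n → ℝ)))
    rwa [Set.inter_comm] at this
  -- Continuous induction: the Lipschitz constants are only local, so it must be shown that order at
  -- a time `s` persists slightly beyond `s`.
  refine hclosed.Icc_subset_of_forall_exists_gt (framerGap_nonneg_iff.2 h0) ?_
    (Set.right_mem_Icc.2 hT)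
  rintro s ⟨hs0 : 0 ≤ e s, hsT⟩ y hy
  have hsI : s ∈ Set.Ici (0 : ℝ) := hsT.1
  obtain ⟨hlo, hup⟩ := framerGap_nonneg_iff.1 hs0
  -- At `s` the projection is the state itself, so by continuity both remain in the same Lipschitz
  -- neighbourhood for a short time.
  have hp : boxClamp (xup s) (xlo s) (x s) = x s := boxClamp_eq_self hlo hup
  obtain ⟨Kf, Vf, hVf, Uf, hUf, hLf⟩ := hf.locallyLipschitz s hsI _ (hx s hsI).1
  obtain ⟨Kh, Vh, hVh, Uh, hUh, hLh⟩ := hh.locallyLipschitz s hsI _ (hx s hsI).1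
  have htx : Filter.Tendsto x (𝓝[Set.Ici 0] s) (𝓝[𝒳] (x s)) :=
    tendsto_nhdsWithin_iff.2 ⟨hxc s hsI, eventually_mem_nhdsWithin.mono fun t ht => (hx t ht).1⟩
  have htp : Filter.Tendsto (fun t => boxClamp (xup t) (xlo t) (x t)) (𝓝[Set.Ici 0] s)
      (𝓝[𝒳] (x s)) := by
    refine tendsto_nhdsWithin_iff.2 ⟨?_, eventually_mem_nhdsWithin.mono fun t ht => ?_⟩
    · have := hpc s hsI
      rwa [ContinuousWithinAt, hp] at this
    · exact Set.uIcc_comm (xlo t) (xup t) ▸ (hs t ht).1 <| boxClamp_mem _ _ _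
  have hev : ∀ᶠ t in 𝓝[Set.Ici 0] s, (t ∈ Vf ∧ t ∈ Vh) ∧ (x t ∈ Uf ∧ x t ∈ Uh) ∧
      boxClamp (xup t) (xlo t) (x t) ∈ Uf ∧ boxClamp (xup t) (xlo t) (x t) ∈ Uh := by
    filter_upwards [hVf, hVh, htx hUf, htx hUh, htp hUf, htp hUh] with t h1 h2 h3 h4 h5 h6
    exact ⟨⟨h1, h2⟩, ⟨h3, h4⟩, h5, h6⟩
  have hev' := hev.filter_mono (nhdsWithin_mono s (Set.Ici_subset_Ici.2 hsI))
  obtain ⟨u, hu, husub⟩ := mem_nhdsGE_iff_exists_Icc_subset.1 hev'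
  obtain ⟨K, hK, hbound⟩ := exists_framerField_gap_bound (𝒳 := 𝒳) (widthBound Jflo Jfup A)
    (widthBound Jhlo Jhup C) hL (matDiag_add_matPos_sub_matNeg (A - L * C))
    (IsMetzler.upper (A - L * C)) (matNeg_nonneg (matOffDiag (A - L * C))) Kf Kh
  have hnonneg := nonneg_of_deriv_ge (a := s) (b := u) hK
    (hec.mono fun t ht => hsI.trans ht.1)
    (fun t ht => (hed t (hsI.trans ht.1)).mono (Set.Ici_subset_Ici.2 (hsI.trans ht.1))) hs0
    (fun t ht => by
      have ht0 : t ∈ Set.Ici (0 : ℝ) := hsI.trans ht.1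
      obtain ⟨⟨h1, h2⟩, ⟨h3, h4⟩, h5, h6⟩ := husub (Set.Ico_subset_Icc_self ht)
      exact hbound (f t) (h t) (Jf t) (Jh t) Uf Uh (xup t) (xlo t) (x t)
        (hf.hasJSSRemainder ht0 (hsf t ht0)) (hh.hasJSSRemainder ht0 (hsh t ht0))
        (hLf t h1) (hLh t h2) (Set.uIcc_comm (xlo t) (xup t) ▸ (hs t ht0).1) h3 h5 h4 h6)
  exact ⟨min u y, hnonneg _ ⟨le_min (le_of_lt hu) (le_of_lt hy), min_le_left _ _⟩,
    lt_min hu hy, min_le_right _ _⟩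

end CorrectnessCT

theorem isCorrectFramer_dt {n l : ℕ} {𝒳 : Set (Fin n → ℝ)}
    {A Jflo Jfup : Matrix (Fin n) (Fin n) ℝ}
    {C Jhlo Jhup : Matrix (Fin l) (Fin n) ℝ} {L : Matrix (Fin n) (Fin l) ℝ}
    {f : ℕ → (Fin n → ℝ) → (Fin n → ℝ)} {h : ℕ → (Fin n → ℝ) → (Fin l → ℝ)}
    {Jf : ℕ → (Fin n → ℝ) → Matrix (Fin n) (Fin n) ℝ}
    {Jh : ℕ → (Fin n → ℝ) → Matrix (Fin l) (Fin n) ℝ} {x xup xlo : ℕ → Fin n → ℝ}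
    (hf : HasBoundedJacobian Set.univ 𝒳 f Jf Jflo Jfup)
    (hh : HasBoundedJacobian Set.univ 𝒳 h Jh Jhlo Jhup)
    (hsf : ∀ t, IsJSS 𝒳 (fun x => Jf t x - A)) (hsh : ∀ t, IsJSS 𝒳 (fun x => Jh t x - C))
    (hL : ∀ i j, 0 ≤ L i j) (hx : IsPlantTrajectoryDT 𝒳 f x)
    (h0 : x 0 ∈ Set.Icc (xlo 0) (xup 0))
    (hs : IsFramerSolutionDT 𝒳 A C L f h Jf Jh (fun t => h t (x t)) xup xlo) :
    IsCorrectFramer Set.univ x xup xlo := by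
  intro t _
  induction t with
  | zero => exact h0
  | succ t ih =>
    obtain ⟨hlo, hup⟩ := ih trivial
    obtain ⟨hbox, hu, hl⟩ := hs t
    rw [Set.uIcc_comm] at hbox
    have hmem : x t ∈ Set.uIcc (xup t) (xlo t) := by
      rw [Set.uIcc_of_ge (hlo.trans hup)]; exact ⟨hlo, hup⟩
    have hRf := hf.hasJSSRemainder (Set.mem_univ t) (hsf t)
    have hRh := hh.hasJSSRemainder (Set.mem_univ t) (hsh t)
    have hv : (xlo t - xup t) ⊔ 0 = 0 := sup_eq_right.2 (sub_nonpos.2 (hlo.trans hup))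
    have hM := matPos_sub_matNeg (A - L * C)
    have hnn : ∀ M N : Matrix (Fin n) (Fin n) ℝ, (∀ i j, 0 ≤ M i j) → (∀ i j, 0 ≤ N i j) →
        ∀ v w : Fin n → ℝ, 0 ≤ v → 0 ≤ w → 0 ≤ M *ᵥ v + N *ᵥ w := by
      intro M N hM hN v w hv hw
      have h1 := mulVec_mono_right hM hv
      have h2 := mulVec_mono_right hN hw
      rw [Matrix.mulVec_zero] at h1 h2
      exact add_nonneg h1 h2
    -- With `v = x t` the increments of `f` and `h` vanish, as does the disorder term, leaving
    -- nonnegative matrices applied to nonnegative gaps.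
    have h1 := le_framerField_sub hRf hRh hL hM hbox hmem (x t)
    have h2 := le_sub_framerField hRf hRh hL hM hbox hmem (x t)
    rw [← hu, ← (hx t).2, hv] at h1
    rw [← hl, ← (hx t).2, hv] at h2
    simp only [sub_self, Matrix.mulVec_zero, add_zero, sub_zero] at h1 h2
    exact ⟨sub_nonneg.1 ((hnn _ _ (matPos_nonneg _) (matNeg_nonneg _) _ _
        (sub_nonneg.2 hlo) (sub_nonneg.2 hup)).trans h2),
      sub_nonneg.1 ((hnn _ _ (matPos_nonneg _) (matNeg_nonneg _) _ _
        (sub_nonneg.2 hup) (sub_nonneg.2 hlo)).trans h1)⟩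

/-! ### Positive quadratic forms and nonnegativity of the gain -/

theorem IsNegDef.dotProduct_mulVec_neg {ι : Type} [Fintype ι] {M : Matrix ι ι ℝ} (hM : IsNegDef M)
    {v : ι → ℝ} (hv : v ≠ 0) : v ⬝ᵥ (M *ᵥ v) < 0 := by
  have := Matrix.PosDef.dotProduct_mulVec_pos hM hv
  simpa [Matrix.neg_mulVec] using this

theorem IsNegDef.fromBlocks_neg {n : ℕ} {Q R S T : Matrix (Fin n) (Fin n) ℝ}
    (hM : IsNegDef (Matrix.fromBlocks Q R S T)) {v w : Fin n → ℝ} (hvw : v ≠ 0 ∨ w ≠ 0) :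
    v ⬝ᵥ (Q *ᵥ v) + v ⬝ᵥ (R *ᵥ w) + (w ⬝ᵥ (S *ᵥ v) + w ⬝ᵥ (T *ᵥ w)) < 0 := by
  have hne : Sum.elim v w ≠ 0 := by
    intro h
    rcases hvw with hv | hw
    · exact hv (funext fun i => congrFun h (Sum.inl i))
    · exact hw (funext fun i => congrFun h (Sum.inr i))
  have := hM.dotProduct_mulVec_neg hne
  rw [Matrix.fromBlocks_mulVec] at this
  simpa [dotProduct_add] using this

section MMatrix

variable {n : ℕ} {X : Matrix (Fin n) (Fin n) ℝ}

theorem dotProduct_mulVec_pos_of_add_transpose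
    (h : ∀ v : Fin n → ℝ, v ≠ 0 → 0 < v ⬝ᵥ ((X + Xᵀ) *ᵥ v)) {v : Fin n → ℝ} (hv : v ≠ 0) :
    0 < v ⬝ᵥ (X *ᵥ v) := by
  have h1 := h v hv
  have h2 : v ⬝ᵥ (Xᵀ *ᵥ v) = v ⬝ᵥ (X *ᵥ v) := by
    rw [Matrix.mulVec_transpose, dotProduct_comm, Matrix.dotProduct_mulVec]
  rw [Matrix.add_mulVec, dotProduct_add, h2] at h1
  linarith

theorem isUnit_det_of_dotProduct_mulVec_pos
    (h : ∀ v : Fin n → ℝ, v ≠ 0 → 0 < v ⬝ᵥ (X *ᵥ v)) : IsUnit X.det := by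
  rw [isUnit_iff_ne_zero]
  intro h0
  obtain ⟨v, hv, hXv⟩ := Matrix.exists_mulVec_eq_zero_iff.2 h0
  have := h v hv
  simp [hXv] at this

/-- A matrix with positive definite quadratic form and nonpositive off-diagonal entries is inverse
nonnegative. -/
theorem nonneg_of_mulVec_nonneg (h : ∀ v : Fin n → ℝ, v ≠ 0 → 0 < v ⬝ᵥ (X *ᵥ v))
    (hX : IsMetzler (-X)) {z : Fin n → ℝ} (hz : 0 ≤ X *ᵥ z) : 0 ≤ z := by
  -- Testing with the negative part of `z` gives `0 ≤ w ⬝ X z ≤ -(w ⬝ X w)`, which forces `w = 0`.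
  set w : Fin n → ℝ := (-z) ⊔ 0 with hw
  have hw0 : 0 ≤ w := le_sup_right
  have hle : w ⬝ᵥ (X *ᵥ z) ≤ -(w ⬝ᵥ (X *ᵥ w)) := by
    rw [← dotProduct_neg, ← Matrix.mulVec_neg]
    simp only [dotProduct, Matrix.mulVec, Finset.mul_sum]
    refine Finset.sum_le_sum fun i _ => Finset.sum_le_sum fun j _ => ?_
    by_cases hij : i = j
    · subst hij
      rcases le_total (z i) 0 with hi | hi
      · simp [hw, hi]
      · simp [hw, hi]
    · have h1 := hX i j hij
      rw [Matrix.neg_apply] at h1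
      have h2 : (-w) j ≤ z j := by
        simp only [hw, Pi.neg_apply, Pi.sup_apply, Pi.zero_apply]
        rw [neg_le]; exact le_sup_left
      exact mul_le_mul_of_nonneg_left (mul_le_mul_of_nonpos_left h2 (by linarith)) (hw0 i)
  have hge : 0 ≤ w ⬝ᵥ (X *ᵥ z) := dotProduct_nonneg_of_nonneg hw0 hz
  have hw1 : w = 0 := by
    by_contra hne
    linarith [h w hne]
  have := sup_eq_right.1 hw1
  exact neg_nonpos.1 this

/-- Each column of the gain solves a linear system with matrix `Xᵀ` and right-hand side a column of
`-Jᵀ ≥ 0`. -/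
theorem gain_nonneg {l : ℕ} {J : Matrix (Fin l) (Fin n) ℝ}
    (h : ∀ v : Fin n → ℝ, v ≠ 0 → 0 < v ⬝ᵥ (Xᵀ *ᵥ v)) (hX : IsMetzler (-X))
    (hJ : IsNonposMatrix J) (i j) : 0 ≤ gain X J i j := by
  have hu := isUnit_det_of_dotProduct_mulVec_pos h
  have hXL : Xᵀ * gain X J = -Jᵀ := by
    rw [gain, Matrix.mul_neg, Matrix.mul_nonsing_inv_cancel_left _ _ hu]
  have hcol : Xᵀ *ᵥ (fun i => gain X J i j) = fun i => -J j i := by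
    ext i
    exact congrFun (congrFun hXL i) j
  have hz : 0 ≤ fun i => gain X J i j :=
    nonneg_of_mulVec_nonneg h (fun a b hab => hX b a hab.symm)
      (hcol ▸ fun i => neg_nonneg.2 (hJ j i))
  exact hz i

theorem transpose_mul_gain {l : ℕ} {J : Matrix (Fin l) (Fin n) ℝ} (hu : IsUnit X.det) :
    Xᵀ * gain X J = -Jᵀ := by
  rw [gain, Matrix.mul_neg, Matrix.mul_nonsing_inv_cancel_left _ _ (by rwa [Matrix.det_transpose])]

end MMatrix

/-! ### Coercivity and Lyapunov convergence -/

section Coercivity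

variable {n : ℕ} {Q : Matrix (Fin n) (Fin n) ℝ}

/-- Compactness of the unit sphere bounds the form away from zero there; homogeneity does the rest.
-/
theorem exists_pos_mul_norm_sq_le (hQ : ∀ v : Fin n → ℝ, v ≠ 0 → 0 < v ⬝ᵥ (Q *ᵥ v)) :
    ∃ q : ℝ, 0 < q ∧ ∀ v : Fin n → ℝ, q * ‖v‖ ^ 2 ≤ v ⬝ᵥ (Q *ᵥ v) := by
  have hc : Continuous fun v : Fin n → ℝ => v ⬝ᵥ (Q *ᵥ v) := by fun_prop
  obtain ⟨q, hq, h⟩ := (isCompact_sphere (0 : Fin n → ℝ) 1).exists_forall_le' hc.continuousOn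
    (a := 0) (fun v hv => hQ v (ne_zero_of_mem_unit_sphere ⟨v, hv⟩))
  refine ⟨q, hq, fun v => ?_⟩
  by_cases hv : v = 0
  · simp [hv]
  have hn : 0 < ‖v‖ := norm_pos_iff.2 hv
  have h1 := h (‖v‖⁻¹ • v) (by simp [norm_smul, hn.ne'])
  rw [Matrix.mulVec_smul, smul_dotProduct, dotProduct_smul, smul_eq_mul, smul_eq_mul, ← mul_assoc,
    ← sq, inv_pow, ← div_eq_inv_mul, le_div_iff₀ (by positivity)] at h1
  exact h1

theorem dotProduct_mulVec_le_norm_sq (R : Matrix (Fin n) (Fin n) ℝ) (v : Fin n → ℝ) :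
    v ⬝ᵥ (R *ᵥ v) ≤ (∑ i, ∑ j, |R i j|) * ‖v‖ ^ 2 := by
  simp only [dotProduct, Matrix.mulVec, Finset.mul_sum, Finset.sum_mul]
  refine Finset.sum_le_sum fun i _ => Finset.sum_le_sum fun j _ => ?_
  calc v i * (R i j * v j) ≤ |v i * (R i j * v j)| := le_abs_self _
    _ = |R i j| * (|v i| * |v j|) := by rw [abs_mul, abs_mul]; ring
    _ ≤ |R i j| * ‖v‖ ^ 2 := by
      rw [sq]
      gcongr
      · exact norm_le_pi_norm v i
      · exact norm_le_pi_norm v j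

theorem exists_pos_mul_le_dotProduct (hQ : ∀ v : Fin n → ℝ, v ≠ 0 → 0 < v ⬝ᵥ (Q *ᵥ v))
    (R : Matrix (Fin n) (Fin n) ℝ) :
    ∃ c : ℝ, 0 < c ∧ ∀ v : Fin n → ℝ, c * (v ⬝ᵥ (R *ᵥ v)) ≤ v ⬝ᵥ (Q *ᵥ v) := by
  obtain ⟨q, hq, h⟩ := exists_pos_mul_norm_sq_le hQ
  set r := ∑ i, ∑ j, |R i j| with hr
  have hr0 : 0 ≤ r := by positivity
  refine ⟨q / (r + 1), by positivity, fun v => le_trans ?_ (h v)⟩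
  have h1 := dotProduct_mulVec_le_norm_sq R v
  rw [← hr] at h1
  rw [div_mul_eq_mul_div, div_le_iff₀ (by positivity), mul_assoc]
  exact mul_le_mul_of_nonneg_left (by nlinarith [sq_nonneg ‖v‖]) hq.le

theorem tendsto_norm_of_dotProduct_mulVec {T : Type*} {𝓕 : Filter T}
    (hQ : ∀ v : Fin n → ℝ, v ≠ 0 → 0 < v ⬝ᵥ (Q *ᵥ v)) {e : T → Fin n → ℝ}
    (he : Filter.Tendsto (fun t => e t ⬝ᵥ (Q *ᵥ e t)) 𝓕 (𝓝 0)) :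
    Filter.Tendsto (fun t => ‖e t‖) 𝓕 (𝓝 0) := by
  obtain ⟨q, hq, h⟩ := exists_pos_mul_norm_sq_le hQ
  have h1 : Filter.Tendsto (fun t => √((e t ⬝ᵥ (Q *ᵥ e t)) / q)) 𝓕 (𝓝 0) := by
    have := (he.div_const q).sqrt
    simpa using this
  refine squeeze_zero (fun _ => norm_nonneg _) (fun t => ?_) h1
  refine Real.le_sqrt_of_sq_le ?_
  rw [le_div_iff₀ hq, mul_comm]
  exact h (e t)

end Coercivity

/-- A nonnegative curve with `ė ≤ N e` tends to zero when `N` has a diagonal Lyapunov matrix. -/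
theorem tendsto_norm_of_deriv_le {n : ℕ} {N : Matrix (Fin n) (Fin n) ℝ} {d : Fin n → ℝ}
    (hd : ∀ v : Fin n → ℝ, v ≠ 0 → 0 < v ⬝ᵥ (Matrix.diagonal d *ᵥ v)) (hd0 : 0 ≤ d)
    (hN : ∀ v : Fin n → ℝ, v ≠ 0 → 0 < v ⬝ᵥ (-(Matrix.diagonal d * N) *ᵥ v))
    {e e' : ℝ → Fin n → ℝ} (he : ∀ t ∈ Set.Ici (0 : ℝ), HasDerivWithinAt e (e' t) (Set.Ici 0) t)
    (he0 : ∀ t ∈ Set.Ici (0 : ℝ), 0 ≤ e t) (hle : ∀ t ∈ Set.Ici (0 : ℝ), e' t ≤ N *ᵥ e t) :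
    Filter.Tendsto (fun t => ‖e t‖) Filter.atTop (𝓝 0) := by
  obtain ⟨c, hc, hcN⟩ := exists_pos_mul_le_dotProduct hN (Matrix.diagonal d)
  set V : ℝ → ℝ := fun t => ∑ i, d i * e t i ^ 2 with hV
  have hVeq : ∀ t, e t ⬝ᵥ (Matrix.diagonal d *ᵥ e t) = V t := by
    intro t
    simp only [dotProduct, Matrix.mulVec_diagonal, hV]
    exact Finset.sum_congr rfl fun i _ => by ring
  have hVd : ∀ t ∈ Set.Ici (0 : ℝ), HasDerivWithinAt V (∑ i, d i * (2 * e t i * e' t i))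
      (Set.Ici 0) t := by
    intro t ht
    refine HasDerivWithinAt.fun_sum fun i _ => ?_
    simpa using ((hasDerivWithinAt_pi.1 (he t ht) i).pow 2).const_mul (d i)
  have hVle : ∀ t ∈ Set.Ici (0 : ℝ), ∑ i, d i * (2 * e t i * e' t i) ≤ -(2 * c) * V t := by
    intro t ht
    -- The inequality for `e'` is only entrywise. It survives here because a diagonal Lyapunov
    -- matrix multiplies row `i` by the nonnegative weight `d i * e t i`.
    have h1 : ∑ i, d i * (2 * e t i * e' t i) ≤
        2 * (e t ⬝ᵥ (Matrix.diagonal d *ᵥ (N *ᵥ e t))) := by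
      rw [dotProduct, Finset.mul_sum]
      refine Finset.sum_le_sum fun i _ => ?_
      rw [Matrix.mulVec_diagonal]
      have := mul_le_mul_of_nonneg_left (hle t ht i) (mul_nonneg (hd0 i) (he0 t ht i))
      linarith
    have h2 := hcN (e t)
    rw [hVeq, Matrix.neg_mulVec, dotProduct_neg, ← Matrix.mulVec_mulVec] at h2
    linarith
  have hbound : ∀ t ∈ Set.Ici (0 : ℝ), V t ≤ V 0 * Real.exp (-(2 * c) * t) := by
    intro t ht
    have := le_mul_exp_of_deriv_le (a := 0) (b := t)
      (fun s hs => (hVd s hs.1).continuousWithinAt.mono Set.Icc_subset_Ici_self)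
      (fun s hs => (hVd s hs.1).mono (Set.Ici_subset_Ici.2 hs.1)) (fun s hs => hVle s hs.1)
      t ⟨ht, le_rfl⟩
    simpa using this
  refine tendsto_norm_of_dotProduct_mulVec hd ?_
  simp only [hVeq]
  have hexp : Filter.Tendsto (fun t : ℝ => V 0 * Real.exp (-(2 * c) * t)) Filter.atTop (𝓝 0) := by
    have := (Real.tendsto_exp_atBot.comp
      (Filter.tendsto_id.const_mul_atTop_of_neg (r := -(2 * c)) (by linarith))).const_mul (V 0)
    simpa using this
  refine squeeze_zero' (Filter.Eventually.of_forall fun t => ?_)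
    ((Filter.eventually_ge_atTop 0).mono hbound) hexp
  exact Finset.sum_nonneg fun i _ => mul_nonneg (hd0 i) (sq_nonneg _)

/-- A nonnegative sequence with `e (t + 1) ≤ N e t` tends to zero when the nonnegative matrix `N`
has a quadratic Lyapunov function. -/
theorem tendsto_norm_of_succ_le {n : ℕ} {N P : Matrix (Fin n) (Fin n) ℝ}
    (hP : ∀ v : Fin n → ℝ, v ≠ 0 → 0 < v ⬝ᵥ (P *ᵥ v)) (hN0 : ∀ i j, 0 ≤ N i j)
    (hN : ∀ v : Fin n → ℝ, v ≠ 0 → 0 < v ⬝ᵥ ((P - Nᵀ * P * N) *ᵥ v))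
    {e : ℕ → Fin n → ℝ} (he0 : ∀ t, 0 ≤ e t) (hle : ∀ t, e (t + 1) ≤ N *ᵥ e t) :
    Filter.Tendsto (fun t => ‖e t‖) Filter.atTop (𝓝 0) := by
  obtain ⟨c, hc, hcN⟩ := exists_pos_mul_le_dotProduct hN P
  have hP0 : ∀ v : Fin n → ℝ, 0 ≤ v ⬝ᵥ (P *ᵥ v) := fun v => by
    by_cases hv : v = 0
    · simp [hv]
    · exact (hP v hv).le
  -- The form of `P` need not be monotone in the entrywise order, so the Lyapunov argument is
  -- applied to the exact linear iteration, which dominates `e` because `N ≥ 0`.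
  set η : ℕ → Fin n → ℝ := fun t => (fun v => N *ᵥ v)^[t] (e 0) with hη
  have hηs : ∀ t, η (t + 1) = N *ᵥ η t := fun t => Function.iterate_succ_apply' _ _ _
  have heη : ∀ t, e t ≤ η t := by
    intro t
    induction t with
    | zero => exact le_rfl
    | succ t ih => exact (hle t).trans ((mulVec_mono_right hN0 ih).trans (hηs t).ge)
  -- The maximum keeps the rate nonnegative, as the induction for `hpow` needs; `c` is only known to
  -- be positive.
  have hstep : ∀ t, η (t + 1) ⬝ᵥ (P *ᵥ η (t + 1)) ≤ (max (1 - c) 0) * (η t ⬝ᵥ (P *ᵥ η t)) := by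
    intro t
    have h1 := hcN (η t)
    rw [Matrix.sub_mulVec, dotProduct_sub, ← Matrix.mulVec_mulVec, ← Matrix.mulVec_mulVec,
      Matrix.dotProduct_mulVec (η t) Nᵀ, Matrix.vecMul_transpose, ← hηs] at h1
    have h2 := mul_le_mul_of_nonneg_right (le_max_left (1 - c) 0) (hP0 (η t))
    linarith
  have hpow : ∀ t, η t ⬝ᵥ (P *ᵥ η t) ≤ (max (1 - c) 0) ^ t * (η 0 ⬝ᵥ (P *ᵥ η 0)) := by
    intro t
    induction t with
    | zero => simp
    | succ t ih =>
      rw [pow_succ', mul_assoc]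
      exact (hstep t).trans (mul_le_mul_of_nonneg_left ih (le_max_right _ _))
  have hηt : Filter.Tendsto (fun t => ‖η t‖) Filter.atTop (𝓝 0) := by
    refine tendsto_norm_of_dotProduct_mulVec hP (squeeze_zero (fun t => hP0 _) hpow ?_)
    have := (tendsto_pow_atTop_nhds_zero_of_lt_one (le_max_right (1 - c) 0)
      (max_lt (by linarith) one_pos)).mul_const (η 0 ⬝ᵥ (P *ᵥ η 0))
    simpa using this
  refine squeeze_zero (fun _ => norm_nonneg _) (fun t => ?_) hηt
  refine (pi_norm_le_iff_of_nonneg (norm_nonneg _)).2 fun i => ?_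
  rw [Real.norm_of_nonneg (he0 t i)]
  exact (heη t i).trans ((le_abs_self _).trans (norm_le_pi_norm (η t) i))

/-! ### Consequences of the matrix inequalities -/

section Conditions

variable {n l : ℕ} {A Fφ P X : Matrix (Fin n) (Fin n) ℝ} {C Fψ J : Matrix (Fin l) (Fin n) ℝ}
  {α : ℝ}

theorem ConditionsCT.dotProduct_pos (hα : 0 < α) (h : ConditionsCT α A C Fφ Fψ P X J)
    {v : Fin n → ℝ} (hv : v ≠ 0) : 0 < v ⬝ᵥ (X *ᵥ v) := by
  refine dotProduct_mulVec_pos_of_add_transpose (fun v hv => ?_) hv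
  have := h.1.fromBlocks_neg (v := 0) (w := v) (Or.inr hv)
  simp only [zero_dotProduct, Matrix.mulVec_zero, dotProduct_zero, zero_add, Matrix.neg_mulVec,
    dotProduct_neg, Matrix.smul_mulVec, dotProduct_smul, smul_eq_mul] at this
  exact pos_of_mul_pos_right (by linarith) hα.le

theorem Matrix.IsDiag.isMetzler_neg (h : X.IsDiag) : IsMetzler (-X) := fun i j hij => by
  rw [Matrix.neg_apply, h hij, neg_zero]

/-- The comparison matrix of the continuous-time framer error. -/
def errorMatrixCT (A Fφ : Matrix (Fin n) (Fin n) ℝ) (C Fψ : Matrix (Fin l) (Fin n) ℝ)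
    (L : Matrix (Fin n) (Fin l) ℝ) : Matrix (Fin n) (Fin n) ℝ :=
  matMetzlerization A + Fφ - L * (C - Fψ)

/-- The comparison matrix of the discrete-time framer error. -/
def errorMatrixDT (A Fφ : Matrix (Fin n) (Fin n) ℝ) (C Fψ : Matrix (Fin l) (Fin n) ℝ)
    (L : Matrix (Fin n) (Fin l) ℝ) : Matrix (Fin n) (Fin n) ℝ :=
  matAbs A + Fφ + L * (matAbs C + Fψ)

/-- Substituting `Xᵀ L = -Jᵀ` makes the symmetrization of `Xᵀ N` equal to `Ω`, which is isolated by
the test vector `(v, 0)`. -/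
theorem ConditionsCT.errorMatrix_neg (hu : IsUnit X.det) (h : ConditionsCT α A C Fφ Fψ P X J)
    {v : Fin n → ℝ} (hv : v ≠ 0) :
    0 < v ⬝ᵥ (-(Xᵀ * errorMatrixCT A Fφ C Fψ (gain X J)) *ᵥ v) := by
  have hXN : Xᵀ * errorMatrixCT A Fφ C Fψ (gain X J) =
      Xᵀ * (matMetzlerization A + Fφ) + Jᵀ * (C - Fψ) := by
    rw [errorMatrixCT, Matrix.mul_sub, ← Matrix.mul_assoc, transpose_mul_gain hu, Matrix.neg_mul,
      sub_neg_eq_add]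
  refine dotProduct_mulVec_pos_of_add_transpose (fun v hv => ?_) hv
  have := h.1.fromBlocks_neg (v := v) (w := 0) (Or.inl hv)
  simp only [zero_dotProduct, Matrix.mulVec_zero, dotProduct_zero, add_zero] at this
  rw [hXN, Matrix.transpose_neg, ← neg_add, Matrix.neg_mulVec, dotProduct_neg, neg_pos]
  refine lt_of_eq_of_lt (congrArg (fun M => v ⬝ᵥ (M *ᵥ v)) ?_) this
  simp only [Matrix.transpose_add, Matrix.transpose_sub, Matrix.transpose_mul,
    Matrix.transpose_transpose, Matrix.add_mul, Matrix.mul_add]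
  abel

/-- With `X` diagonal, row `i` reads `X i i * (L C) i j = -(Jᵀ C) i j`, and `X i i > 0`. -/
theorem ConditionsCT.gain_mul_nonpos (hα : 0 < α) (h : ConditionsCT α A C Fφ Fψ P X J)
    {i j : Fin n} (hij : i ≠ j) : (gain X J * C) i j ≤ 0 := by
  have hu := isUnit_det_of_dotProduct_mulVec_pos fun v hv => h.dotProduct_pos hα hv
  have h1 : Xᵀ * (gain X J * C) = -(Jᵀ * C) := by
    rw [← Matrix.mul_assoc, transpose_mul_gain hu, Matrix.neg_mul]
  have hsum : (Xᵀ * (gain X J * C)) i j = X i i * (gain X J * C) i j := by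
    rw [Matrix.mul_apply, Finset.sum_eq_single i]
    · rfl
    · intro k _ hk
      rw [Matrix.transpose_apply, h.2.2 hk, zero_mul]
    · simp
  have hii : 0 < X i i := by
    have := h.dotProduct_pos hα (v := Pi.single i 1) (by simp)
    simpa using this
  have h2 := h.2.1 i j hij
  rw [h1, Matrix.neg_apply] at hsum
  by_contra! hpos
  nlinarith [mul_pos hii hpos]

/-- Diagonal entries agree, as they carry no absolute value. Off the diagonal `|A - L C| ≤ |A| + |L
C| = |A| - L C` by the sign of `L C`; this makes the bound linear in `L`. -/
theorem ConditionsCT.errorMatrix_ge (hα : 0 < α) (h : ConditionsCT α A C Fφ Fψ P X J) (i j) :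
    (matDiag (A - gain X J * C) + matPos (matOffDiag (A - gain X J * C)) +
        matNeg (matOffDiag (A - gain X J * C)) + Fφ + gain X J * Fψ) i j ≤
      errorMatrixCT A Fφ C Fψ (gain X J) i j := by
  rw [errorMatrixCT, matMetzlerization, add_assoc (matDiag _), ← matAbs, Matrix.mul_sub]
  simp only [Matrix.add_apply, Matrix.sub_apply, matAbs_apply, matOffDiag_apply]
  by_cases hij : i = j
  · subst hij
    simp [matDiag]
    linarith
  · have h1 := h.gain_mul_nonpos hα hij
    simp only [matDiag, hij, if_false, Matrix.diagonal_apply_ne _ hij]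
    have h2 := abs_sub (A i j) ((gain X J * C) i j)
    rw [abs_of_nonpos h1] at h2
    linarith

theorem ConditionsDT.dotProduct_pos (hP : P.PosDef) (h : ConditionsDT A C Fφ Fψ P X J)
    {v : Fin n → ℝ} (hv : v ≠ 0) : 0 < v ⬝ᵥ (X *ᵥ v) := by
  refine dotProduct_mulVec_pos_of_add_transpose (fun v hv => ?_) hv
  have h1 := h.1.fromBlocks_neg (v := 0) (w := v) (Or.inr hv)
  have h2 : 0 < v ⬝ᵥ (P *ᵥ v) := hP.dotProduct_mulVec_pos hv
  simp only [zero_dotProduct, Matrix.mulVec_zero, dotProduct_zero, zero_add, sub_sub,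
    Matrix.sub_mulVec, dotProduct_sub] at h1
  linarith

theorem ConditionsDT.errorMatrix_pos (hu : IsUnit X.det) (h : ConditionsDT A C Fφ Fψ P X J)
    {v : Fin n → ℝ} (hv : v ≠ 0) :
    0 < v ⬝ᵥ ((P - (errorMatrixDT A Fφ C Fψ (gain X J))ᵀ * P *
      errorMatrixDT A Fφ C Fψ (gain X J)) *ᵥ v) := by
  set N := errorMatrixDT A Fφ C Fψ (gain X J) with hN
  have hXN : Xᵀ * N = Xᵀ * (matAbs A + Fφ) - Jᵀ * (matAbs C + Fψ) := by
    rw [hN, errorMatrixDT, Matrix.mul_add, ← Matrix.mul_assoc, transpose_mul_gain hu,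
      Matrix.neg_mul, ← sub_eq_add_neg]
  have hΓ : ((matAbs A)ᵀ + Fφᵀ) * X - ((matAbs C)ᵀ + Fψᵀ) * J = Nᵀ * X := by
    rw [← Matrix.transpose_transpose (Nᵀ * X), Matrix.transpose_mul, Matrix.transpose_transpose,
      hXN]
    simp
  -- With `Γ = Nᵀ X`, this choice of `w` cancels every term in `X` and leaves `(N v) ⬝ P (N v) < v ⬝
  -- P v`.
  have h1 := h.1.fromBlocks_neg (v := v) (w := N *ᵥ v) (Or.inl hv)
  have hadj : ∀ w : Fin n → ℝ, v ⬝ᵥ (Nᵀ *ᵥ w) = (N *ᵥ v) ⬝ᵥ w := fun w => by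
    rw [Matrix.dotProduct_mulVec, Matrix.vecMul_transpose]
  rw [hΓ, Matrix.transpose_mul, Matrix.transpose_transpose] at h1
  simp only [Matrix.sub_mulVec, Matrix.neg_mulVec, dotProduct_sub, dotProduct_neg,
    ← Matrix.mulVec_mulVec, hadj] at h1 ⊢
  linarith

theorem errorMatrixDT_ge {L : Matrix (Fin n) (Fin l) ℝ} (hL : ∀ i j, 0 ≤ L i j) (i j) :
    (matPos (A - L * C) + matNeg (A - L * C) + Fφ + L * Fψ) i j ≤
      errorMatrixDT A Fφ C Fψ L i j := by
  rw [errorMatrixDT, ← matAbs, Matrix.mul_add]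
  simp only [Matrix.add_apply, matAbs_apply, Matrix.sub_apply]
  have h1 := abs_sub (A i j) ((L * C) i j)
  have h2 : |(L * C) i j| ≤ (L * matAbs C) i j := by
    simp only [Matrix.mul_apply]
    refine (Finset.abs_sum_le_sum_abs _ _).trans (Finset.sum_le_sum fun k _ => ?_)
    rw [abs_mul, abs_of_nonneg (hL i k), matAbs_apply]
  linarith

theorem errorMatrixDT_nonneg {L : Matrix (Fin n) (Fin l) ℝ} (hL : ∀ i j, 0 ≤ L i j)
    (hφ : ∀ i j, 0 ≤ Fφ i j) (hψ : ∀ i j, 0 ≤ Fψ i j) (i j) :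
    0 ≤
      errorMatrixDT A Fφ C Fψ L i j := by
  simp only [errorMatrixDT, Matrix.add_apply, Matrix.mul_apply, matAbs_apply]
  exact add_nonneg (add_nonneg (abs_nonneg _) (hφ i j))
    (Finset.sum_nonneg fun k _ => mul_nonneg (hL i k) (add_nonneg (abs_nonneg _) (hψ k j)))

theorem HasJSSRemainder.bound_nonneg {p : ℕ} {𝒳 : Set (Fin n → ℝ)} {H F : Matrix (Fin p) (Fin n) ℝ}
    {g : (Fin n → ℝ) → (Fin p → ℝ)} {Jg : (Fin n → ℝ) → Matrix (Fin p) (Fin n) ℝ}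
    (hg : HasJSSRemainder 𝒳 H g Jg F) {x : Fin n → ℝ} (hx : x ∈ 𝒳) (i j) : 0 ≤ F i j :=
  (abs_nonneg _).trans (hg.abs_le x hx i j)

end Conditions

/-! ### The stability theorem -/

theorem theorem2 {n l s : ℕ} (𝒳 : Set (Fin n → ℝ))
    (fhat : (Fin n → ℝ) → (Fin s → ℝ) → (Fin n → ℝ))
    (hhat : (Fin n → ℝ) → (Fin s → ℝ) → (Fin l → ℝ))
    (A Jflo Jfup : Matrix (Fin n) (Fin n) ℝ) (C Jhlo Jhup : Matrix (Fin l) (Fin n) ℝ)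
    (P X : Matrix (Fin n) (Fin n) ℝ) (J : Matrix (Fin l) (Fin n) ℝ)
    (hP : P.PosDef) (hJ : IsNonposMatrix J) :
    -- continuous time
    (∀ α : ℝ, 0 < α →
      ConditionsCT α A C (widthBound Jflo Jfup A) (widthBound Jhlo Jhup C) P X J →
      IsUnit X.det ∧
      ∀ (u : ℝ → Fin s → ℝ)
        (Jf : ℝ → (Fin n → ℝ) → Matrix (Fin n) (Fin n) ℝ)
        (Jh : ℝ → (Fin n → ℝ) → Matrix (Fin l) (Fin n) ℝ),
        HasBoundedJacobian (Set.Ici 0) 𝒳 (fun t x => fhat x (u t)) Jf Jflo Jfup →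
        HasBoundedJacobian (Set.Ici 0) 𝒳 (fun t x => hhat x (u t)) Jh Jhlo Jhup →
        (∀ t ∈ Set.Ici (0 : ℝ), IsJSS 𝒳 (fun x => Jf t x - A)) →
        (∀ t ∈ Set.Ici (0 : ℝ), IsJSS 𝒳 (fun x => Jh t x - C)) →
        ∀ x xup xlo : ℝ → Fin n → ℝ,
          IsPlantTrajectoryCT 𝒳 (fun t x => fhat x (u t)) x →
          x 0 ∈ Set.Icc (xlo 0) (xup 0) →
          IsFramerSolutionCT 𝒳 A C (gain X J) (fun t x => fhat x (u t)) (fun t x => hhat x (u t))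
            Jf Jh (fun t => hhat (x t) (u t)) xup xlo →
          IsCorrectFramer (Set.Ici 0) x xup xlo ∧ IsStableFramer xup xlo) ∧
    -- discrete time
    (ConditionsDT A C (widthBound Jflo Jfup A) (widthBound Jhlo Jhup C) P X J →
      IsUnit X.det ∧
      ∀ (u : ℕ → Fin s → ℝ)
        (Jf : ℕ → (Fin n → ℝ) → Matrix (Fin n) (Fin n) ℝ)
        (Jh : ℕ → (Fin n → ℝ) → Matrix (Fin l) (Fin n) ℝ),
        HasBoundedJacobian Set.univ 𝒳 (fun t x => fhat x (u t)) Jf Jflo Jfup →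
        HasBoundedJacobian Set.univ 𝒳 (fun t x => hhat x (u t)) Jh Jhlo Jhup →
        (∀ t, IsJSS 𝒳 (fun x => Jf t x - A)) →
        (∀ t, IsJSS 𝒳 (fun x => Jh t x - C)) →
        ∀ x xup xlo : ℕ → Fin n → ℝ,
          IsPlantTrajectoryDT 𝒳 (fun t x => fhat x (u t)) x →
          x 0 ∈ Set.Icc (xlo 0) (xup 0) →
          IsFramerSolutionDT 𝒳 A C (gain X J) (fun t x => fhat x (u t)) (fun t x => hhat x (u t))
            Jf Jh (fun t => hhat (x t) (u t)) xup xlo →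
          IsCorrectFramer Set.univ x xup xlo ∧ IsStableFramer xup xlo) := by

  refine ⟨fun α hα hcond => ?_, fun hcond => ?_⟩
  · have hpos : ∀ v : Fin n → ℝ, v ≠ 0 → 0 < v ⬝ᵥ (X *ᵥ v) := fun v hv =>
      hcond.dotProduct_pos hα hv
    have hu := isUnit_det_of_dotProduct_mulVec_pos hpos
    refine ⟨hu, fun u Jf Jh hf hh hsf hsh x xup xlo hx h0 hs => ?_⟩
    obtain ⟨d, rfl⟩ : ∃ d, X = Matrix.diagonal d := ⟨_, hcond.2.2.diagonal_diag.symm⟩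
    have hd0 : 0 ≤ d := fun i => by
      have := hpos (Pi.single i 1) (by simp)
      simpa using this.le
    have hL : ∀ i j, 0 ≤ gain (Matrix.diagonal d) J i j :=
      gain_nonneg (by simpa using hpos) hcond.2.2.isMetzler_neg hJ
    have hcorrect := isCorrectFramer_ct hf hh hsf hsh hL hx h0 hs
    refine ⟨hcorrect, ?_⟩
    have hε : ∀ t ∈ Set.Ici (0 : ℝ), 0 ≤ xup t - xlo t := fun t ht =>
      sub_nonneg.2 ((hcorrect t ht).1.trans (hcorrect t ht).2)
    refine tendsto_norm_of_deriv_le hpos hd0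
      (fun v hv => by simpa using hcond.errorMatrix_neg hu hv)
      (fun t ht => (hs t ht).2.1.sub (hs t ht).2.2) hε (fun t ht => ?_)
    exact (framerField_sub_swap_le (hf.hasJSSRemainder ht (hsf t ht))
      (hh.hasJSSRemainder ht (hsh t ht)) hL _ (Set.uIcc_comm (xlo t) (xup t) ▸ (hs t ht).1)
      (sub_nonneg.1 (hε t ht))).trans
      (mulVec_mono_left (hcond.errorMatrix_ge hα) (hε t ht))
  · have hpos : ∀ v : Fin n → ℝ, v ≠ 0 → 0 < v ⬝ᵥ (X *ᵥ v) := fun v hv =>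
      hcond.dotProduct_pos hP hv
    have hu := isUnit_det_of_dotProduct_mulVec_pos hpos
    refine ⟨hu, fun u Jf Jh hf hh hsf hsh x xup xlo hx h0 hs => ?_⟩
    have hpos' : ∀ v : Fin n → ℝ, v ≠ 0 → 0 < v ⬝ᵥ (Xᵀ *ᵥ v) := fun v hv => by
      rw [Matrix.mulVec_transpose, dotProduct_comm, ← Matrix.dotProduct_mulVec]
      exact hpos v hv
    have hL := gain_nonneg hpos' hcond.2.2 hJ
    have hcorrect := isCorrectFramer_dt hf hh hsf hsh hL hx h0 hs
    refine ⟨hcorrect, ?_⟩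
    have hRf := fun t => hf.hasJSSRemainder (Set.mem_univ t) (hsf t)
    have hRh := fun t => hh.hasJSSRemainder (Set.mem_univ t) (hsh t)
    have hε : ∀ t, 0 ≤ xup t - xlo t := fun t =>
      sub_nonneg.2 ((hcorrect t trivial).1.trans (hcorrect t trivial).2)
    -- The width bounds are nonnegative because they dominate absolute values of Jacobian entries at
    -- a point of `𝒳`; `x 0` supplies such a point.
    refine tendsto_norm_of_succ_le (fun v hv => hP.dotProduct_mulVec_pos hv)
      (errorMatrixDT_nonneg hL ((hRf 0).bound_nonneg (hx 0).1) ((hRh 0).bound_nonneg (hx 0).1))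
      (fun v hv => hcond.errorMatrix_pos hu hv) hε (fun t => ?_)
    rw [(hs t).2.1, (hs t).2.2]
    exact (framerField_sub_swap_le (hRf t) (hRh t) hL _
      (Set.uIcc_comm (xlo t) (xup t) ▸ (hs t).1) (sub_nonneg.1 (hε t))).trans
      (mulVec_mono_left (errorMatrixDT_ge hL) (hε t))
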